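/- Let $\mathbb F$ be a field of characteristic $p>3$, let $n\ge 3$, and let $\underline t=(t_1,\dots,t_n)$ be an $n$-tuple of positive integers. Put $Y_0=\{1,\dots,n\}$, $Y_1=\{n+1,\dots,2n\}$, $Y=Y_0\cup Y_1$, let $\mu(i)=0$ for $i\in Y_0$ and $\mu(i)=1$ for $i\in Y_1$, and let $i'=i+n$ for $i\in Y_0$ and $i'=i-n$ for $i\in Y_1$. Let $\mathcal O(n,n)=\mathcal O(n)\otimes\Lambda(n)$ be the tensor product of the divided power algebra $\mathcal O(n)$ over $\mathbb F$, with basis $x^{(\alpha)}$ $(\alpha\in\mathbb Z_{\ge0}^n)$ and product $x^{(\alpha)}x^{(\beta)}=\binom{\alpha+\beta}{\alpha}x^{(\alpha+\beta)}$, and the exterior algebra $\Lambda(n)$ in the odd variables $x_{n+1},\dots,x_{2n}$; write $\mathrm p(a)\in\mathbb Z/2$ for the parity of a homogeneous $a$. Let $\partial_r$ $(r\in Y)$ be the superderivations of $\mathcal O(n,n)$ with $\partial_r(x^{(\alpha)}x^u)=x^{(\alpha-\varepsilon_r)}x^u$ (zero if $\alpha_r=0$) for $r\in Y_0$, and $\partial_r(x^{(\alpha)}x^u)=x^{(\alpha)}\,\partial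 x^u/\partial x_r$ (left derivative) for $r\in Y_1$, where $x^u$ runs through the ordered products of distinct odd variables. Let $\mathcal O(n,n;\underline t)$ be the span of the $x^{(\alpha)}x^u$ with $0\le\alpha_i\le p^{t_i}-1$ for all $i\in Y_0$. Define the linear map $\mathrm{T_H}$ from $\mathcal O(n,n;\underline t)$ to the superderivations of $\mathcal O(n,n)$ by $$\mathrm{T_H}(a)=\sum_{i=1}^{2n}(-1)^{\mu(i)\mathrm p(a)}\partial_i(a)\,\partial_{i'}\qquad(a\ \text{homogeneous}),$$ let $HO(n,n;\underline t)=\{\mathrm{T_H}(a)\mid a\in\mathcal O(n,n;\underline t)\}$ be the odd Hamiltonian superalgebra, and let $\mathcal{HO}$ be its even part, a Lie algebra under the commutator. Put $\Gamma=\sum_{i=1}^n x_{i'}\partial_{i'}$. Then, as vector spaces of linear maps on $\mathcal{HO}$, $$\mathrm{Der}(\mathcal{HO})=\mathrm{ad}(\mathcal{HO}+\mathbb F\,\Gamma)\ \oplus\ \mathrm{span}_{\mathbb F}\{(\mathrm{ad}\,\partial_i)^{p^{k}}\mid i\in Y_0,\ 1\le k<t_i\},$$ where $\mathrm{Der}(\mathcal{HO})$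 is the space of all derivations of the Lie algebra $\mathcal{HO}$ and $\mathrm{ad}\,D$ denotes the map $E\mapsto[D,E]$ on $\mathcal{HO}$. In particular the maps on the right send $\mathcal{HO}$ into itself. -/

import Mathlib

namespace OddHamiltonian

/-- The superalgebra `𝒪(n,n) = 𝒪(n) ⊗ Λ(n)`, given by its basis: the index `(α, u)` stands for
`x^(α) x^u`, where `x^(α)` is a divided power monomial in `x_1, …, x_n` and `x^u` is the product, in
increasing order, of the odd variables `x_{i'}` with `i ∈ u` (`i' = n + i`). -/
abbrev O (F : Type*) [Field F] (n : ℕ) : Type _ := ((Fin n → ℕ) × Finset (Fin n)) →₀ F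

/-- The index set `Y = Y₀ ∪ Y₁`; `Sum.inl i` is `i ∈ Y₀` and `Sum.inr i` is `i' ∈ Y₁`. -/
abbrev Y (n : ℕ) : Type := Fin n ⊕ Fin n

section

variable {F : Type*} [Field F] {n : ℕ}

attribute [local instance] LieRing.ofAssociativeRing

/-- The basis element `x^(α) x^u`. -/
noncomputable def mono (α : Fin n → ℕ) (u : Finset (Fin n)) : O F n := Finsupp.single (α, u) 1

/-- `(-1)` to the number of pairs `(i, j) ∈ u × v` with `j < i`: for disjoint `u`, `v` this is
the sign in `x^u x^v = ± x^(u ∪ v)`. -/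
def sgn (F : Type*) [Field F] (u v : Finset (Fin n)) : F :=
  ∏ i ∈ u, ∏ j ∈ v, if j < i then -1 else 1

/-- `∏ i, binom (α_i + β_i) α_i`. -/
def binom (α β : Fin n → ℕ) : ℕ := ∏ i, (α i + β i).choose (α i)

/-- The multiplication of `𝒪(n,n)`. -/
noncomputable def mul : O F n →ₗ[F] O F n →ₗ[F] O F n :=
  Finsupp.linearCombination F fun a : (Fin n → ℕ) × Finset (Fin n) =>
    Finsupp.linearCombination F fun b : (Fin n → ℕ) × Finset (Fin n) =>
      if Disjoint a.2 b.2 then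
        (sgn F a.2 b.2 * (binom a.1 b.1 : F)) • mono (a.1 + b.1) (a.2 ∪ b.2)
      else 0

/-- The superderivations `∂_r`, `r ∈ Y`, of `𝒪(n,n)`; for `r ∈ Y₁` it is the left derivative, so
moving `x_r` to the front of `x^u` gives a sign. -/
noncomputable def del : Y n → Module.End F (O F n)
  | .inl i => Finsupp.linearCombination F fun a : (Fin n → ℕ) × Finset (Fin n) =>
      if a.1 i = 0 then 0 else mono (a.1 - Pi.single i 1) a.2
  | .inr i => Finsupp.linearCombination F fun a : (Fin n → ℕ) × Finset (Fin n) =>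
      if i ∈ a.2 then sgn F {i} a.2 • mono a.1 (a.2.erase i) else 0

/-- The parity `μ` on `Y`, as a natural number. -/
def mu : Y n → ℕ
  | .inl _ => 0
  | .inr _ => 1

/-- The homogeneous components of `𝒪(n,n)` for its `ℤ/2`-gradation. -/
noncomputable def parityPart (F : Type*) [Field F] (n : ℕ) (j : ZMod 2) : Submodule F (O F n) :=
  Finsupp.supported F F {a : (Fin n → ℕ) × Finset (Fin n) | ((a.2.card : ℕ) : ZMod 2) = j}

/-- The linear map `a ↦ (-1)^{p(a)} a`, for homogeneous `a`. -/
noncomputable def parityInv : Module.End F (O F n) :=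
  Finsupp.linearCombination F fun a : (Fin n → ℕ) × Finset (Fin n) =>
    ((-1 : F) ^ a.2.card) • mono a.1 a.2

/-- `T_H(a) = ∑_{i ∈ Y} (-1)^{μ(i) p(a)} ∂_i(a) ∂_{i'}`, as an operator on `𝒪(n,n)`. -/
noncomputable def TH : O F n →ₗ[F] Module.End F (O F n) :=
  ∑ i : Y n, (LinearMap.mulRight F (del (F := F) i.swap)) ∘ₗ
    (mul : O F n →ₗ[F] Module.End F (O F n)) ∘ₗ del i ∘ₗ (parityInv ^ mu i)

/-- `𝒪(n,n;t)`, spanned by the `x^(α) x^u` with `α_i ≤ p^{t_i} - 1`. -/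
noncomputable def OT (F : Type*) [Field F] (p : ℕ) {n : ℕ} (t : Fin n → ℕ) :
    Submodule F (O F n) :=
  Finsupp.supported F F {a : (Fin n → ℕ) × Finset (Fin n) | ∀ i, a.1 i < p ^ t i}

/-- The odd Hamiltonian superalgebra `HO(n,n;t)` as a space of operators on `𝒪(n,n)`. -/
noncomputable def HO (F : Type*) [Field F] (p : ℕ) {n : ℕ} (t : Fin n → ℕ) :
    Submodule F (Module.End F (O F n)) :=
  (OT F p t).map TH

/-- The even operators on `𝒪(n,n)`: those that preserve the parity. -/
noncomputable def evenEnd (F : Type*) [Field F] (n : ℕ) : Submodule F (Module.End F (O F n)) where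
  carrier := {D | ∀ j, ∀ f ∈ parityPart F n j, D f ∈ parityPart F n j}
  add_mem' h₁ h₂ j f hf := add_mem (h₁ j f hf) (h₂ j f hf)
  zero_mem' j _ _ := zero_mem (parityPart F n j)
  smul_mem' c _ h j f hf := (parityPart F n j).smul_mem c (h j f hf)

/-- `Γ = ∑_i x_{i'} ∂_{i'}`. -/
noncomputable def Gam (F : Type*) [Field F] (n : ℕ) : Module.End F (O F n) :=
  ∑ i : Fin n, mul (mono 0 {i}) * del (.inr i)

/-! ### The even part of `HO(n,n;t)` is closed under the commutator -/

lemma mul_mono (α β : Fin n → ℕ) (u v : Finset (Fin n)) :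
    mul (mono α u : O F n) (mono β v) =
      if Disjoint u v then (sgn F u v * (binom α β : F)) • mono (α + β) (u ∪ v) else 0 := by
  simp [mul, mono]

lemma del_inl_mono (i : Fin n) (α : Fin n → ℕ) (u : Finset (Fin n)) :
    del (.inl i) (mono α u : O F n) = if α i = 0 then 0 else mono (α - Pi.single i 1) u := by
  simp [del, mono]

lemma del_inr_mono (i : Fin n) (α : Fin n → ℕ) (u : Finset (Fin n)) :
    del (.inr i) (mono α u : O F n) =
      if i ∈ u then sgn F {i} u • mono α (u.erase i) else 0 := by
  simp [del, mono]

lemma parityInv_mono (α : Fin n → ℕ) (u : Finset (Fin n)) :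
    parityInv (mono α u : O F n) = ((-1 : F) ^ u.card) • mono α u := by
  simp [parityInv, mono]

lemma ext_mono {M : Type*} [AddCommGroup M] [Module F M] {f g : O F n →ₗ[F] M}
    (h : ∀ α u, f (mono α u) = g (mono α u)) : f = g := by
  apply Finsupp.lhom_ext'
  rintro ⟨α, u⟩
  ext
  exact h α u

lemma sgn_union_left {u v w : Finset (Fin n)} (h : Disjoint u v) :
    sgn F (u ∪ v) w = sgn F u w * sgn F v w := Finset.prod_union h

lemma sgn_union_right {u v w : Finset (Fin n)} (h : Disjoint v w) :
    sgn F u (v ∪ w) = sgn F u v * sgn F u w := by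
  simp [sgn, Finset.prod_union h, Finset.prod_mul_distrib]

lemma sgn_comm {u v : Finset (Fin n)} (h : Disjoint u v) :
    sgn F u v = (-1) ^ (u.card * v.card) * sgn F v u := by
  have h2 : sgn F v u = ∏ i ∈ u, ∏ j ∈ v, if i < j then (-1 : F) else 1 := by
    rw [sgn, Finset.prod_comm]
  have h3 : ((-1 : F)) ^ (u.card * v.card) = ∏ i ∈ u, ∏ j ∈ v, (-1 : F) := by
    simp [← pow_mul, mul_comm]
  rw [h2, h3, sgn, ← Finset.prod_mul_distrib]
  refine Finset.prod_congr rfl fun i hi => ?_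
  rw [← Finset.prod_mul_distrib]
  refine Finset.prod_congr rfl fun j hj => ?_
  have : i ≠ j := fun e => Finset.disjoint_left.1 h hi (e ▸ hj)
  rcases lt_or_gt_of_ne this with h | h
  · simp [h, not_lt.2 h.le]
  · simp [h, not_lt.2 h.le]

lemma sgn_mul_self (u v : Finset (Fin n)) : sgn F u v * sgn F u v = 1 := by
  simp only [sgn, ← Finset.prod_mul_distrib]
  refine Finset.prod_eq_one fun i _ => Finset.prod_eq_one fun j _ => ?_
  split_ifs <;> simp

lemma binom_comm (α β : Fin n → ℕ) : binom α β = binom β α := by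
  refine Finset.prod_congr rfl fun i _ => ?_
  rw [add_comm, ← Nat.choose_symm_add]

lemma binom_assoc (α β γ : Fin n → ℕ) :
    binom α β * binom (α + β) γ = binom β γ * binom α (β + γ) := by
  simp only [binom, ← Finset.prod_mul_distrib]
  refine Finset.prod_congr rfl fun i _ => ?_
  have h1 := Nat.add_choose_mul_factorial_mul_factorial (α i) (β i)
  have h2 := Nat.add_choose_mul_factorial_mul_factorial (α i + β i) (γ i)
  have h3 := Nat.add_choose_mul_factorial_mul_factorial (β i) (γ i)
  have h4 := Nat.add_choose_mul_factorial_mul_factorial (α i) (β i + γ i)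
  simp only [Pi.add_apply]
  have e : (α i).factorial * (β i).factorial * (γ i).factorial ≠ 0 := by positivity
  apply Nat.eq_of_mul_eq_mul_right (Nat.pos_of_ne_zero e)
  rw [← Nat.choose_symm_add] at h1 h2 h3 h4
  calc _ = (α i + β i + γ i).choose (α i + β i) *
        ((α i + β i).choose (α i) * (α i).factorial * (β i).factorial) * (γ i).factorial := by ring
    _ = (α i + (β i + γ i)).choose (α i) * (α i).factorial *
        ((β i + γ i).choose (β i) * (β i).factorial * (γ i).factorial) := by
        rw [h1, h2, h3, h4, add_assoc]
    _ = _ := by ring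

lemma mul_assoc' (f g h : O F n) : mul (mul f g) h = mul f (mul g h) := by
  have key : (mul : O F n →ₗ[F] _).compr₂ (mul : O F n →ₗ[F] O F n →ₗ[F] O F n) =
      (((LinearMap.llcomp F (O F n) (O F n) (O F n)).flip ∘ₗ mul).flip ∘ₗ mul) := by
    refine ext_mono fun α u => ext_mono fun β v => ext_mono fun γ w => ?_
    change mul (mul (mono α u) (mono β v)) (mono γ w) =
      mul (mono α u) (mul (mono β v) (mono γ w))
    rw [mul_mono, mul_mono]
    by_cases huv : Disjoint u v <;> by_cases hvw : Disjoint v w <;>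
      by_cases huw : Disjoint u w <;>
      simp [huv, hvw, huw, mul_mono, Finset.disjoint_union_left, Finset.disjoint_union_right]
    rw [sgn_union_left huv, sgn_union_right hvw, smul_smul, smul_smul, add_assoc]
    congr 1
    have := congrArg (Nat.cast (R := F)) (binom_assoc α β γ)
    push_cast at this
    linear_combination (sgn F u v * sgn F u w * sgn F v w) * this
  exact LinearMap.congr_fun (LinearMap.congr_fun (LinearMap.congr_fun key f) g) h

lemma mem_parityPart_mono {α : Fin n → ℕ} {u : Finset (Fin n)} {j : ZMod 2}
    (h : ((u.card : ℕ) : ZMod 2) = j) : (mono α u : O F n) ∈ parityPart F n j :=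
  Finsupp.single_mem_supported F 1 h

lemma mem_OT_mono {p : ℕ} {t : Fin n → ℕ} {α : Fin n → ℕ} {u : Finset (Fin n)}
    (h : ∀ i, α i < p ^ t i) : (mono α u : O F n) ∈ OT F p t :=
  Finsupp.single_mem_supported F 1 h

lemma parityPart_induction {j : ZMod 2} {P : Submodule F (O F n)}
    (h : ∀ α u, ((u.card : ℕ) : ZMod 2) = j → mono α u ∈ P) : parityPart F n j ≤ P := by
  rw [parityPart, Finsupp.supported_eq_span_single, Submodule.span_le]
  rintro _ ⟨⟨α, u⟩, hu, rfl⟩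
  exact h α u hu

lemma OT_induction {p : ℕ} {t : Fin n → ℕ} {P : Submodule F (O F n)}
    (h : ∀ α u, (∀ i, α i < p ^ t i) → mono α u ∈ P) : OT F p t ≤ P := by
  rw [OT, Finsupp.supported_eq_span_single, Submodule.span_le]
  rintro _ ⟨⟨α, u⟩, hu, rfl⟩
  exact h α u hu

lemma neg_one_pow_of_cast {k : ℕ} {j : ZMod 2} (h : (k : ZMod 2) = j) :
    (-1 : F) ^ k = (-1) ^ j.val := by
  subst h
  rw [ZMod.val_natCast]
  exact neg_one_pow_eq_pow_mod_two k

lemma parityInv_apply {j : ZMod 2} {f : O F n} (hf : f ∈ parityPart F n j) :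
    parityInv f = ((-1 : F) ^ j.val) • f := by
  have : parityPart F n j ≤ LinearMap.eqLocus parityInv (((-1 : F) ^ j.val) • LinearMap.id) := by
    refine parityPart_induction fun α u h => ?_
    rw [LinearMap.mem_eqLocus, parityInv_mono, neg_one_pow_of_cast h]
    rfl
  exact this hf

lemma mul_mono_comm (α β : Fin n → ℕ) (u v : Finset (Fin n)) :
    mul (mono α u : O F n) (mono β v) =
      ((-1 : F) ^ (u.card * v.card)) • mul (mono β v) (mono α u) := by
  rw [mul_mono, mul_mono]
  by_cases h : Disjoint u v
  · rw [if_pos h, if_pos h.symm, sgn_comm h, binom_comm, add_comm, Finset.union_comm, smul_smul,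
      mul_assoc]
  · rw [if_neg h, if_neg fun h' => h h'.symm, smul_zero]

lemma mul_comm_parity {i j : ZMod 2} {f g : O F n} (hf : f ∈ parityPart F n i)
    (hg : g ∈ parityPart F n j) : mul f g = ((-1 : F) ^ (i.val * j.val)) • mul g f := by
  have h1 : ∀ α u, ((u.card : ℕ) : ZMod 2) = i → ∀ g ∈ parityPart F n j,
      mul (mono α u : O F n) g = ((-1 : F) ^ (i.val * j.val)) • mul g (mono α u) := by
    intro α u hu g hg
    have : parityPart F n j ≤ LinearMap.eqLocus (mul (mono α u : O F n))
        (((-1 : F) ^ (i.val * j.val)) • mul.flip (mono α u)) := by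
      refine parityPart_induction fun β v hv => ?_
      have e : (-1 : F) ^ (u.card * v.card) = (-1) ^ (i.val * j.val) := by
        rw [pow_mul, neg_one_pow_of_cast hu, ← pow_mul, mul_comm, pow_mul,
          neg_one_pow_of_cast hv, ← pow_mul, mul_comm]
      rw [LinearMap.mem_eqLocus, mul_mono_comm, e]
      rfl
    exact this hg
  have : parityPart F n i ≤ LinearMap.eqLocus (mul.flip g)
      (((-1 : F) ^ (i.val * j.val)) • mul g) :=
    parityPart_induction fun α u hu => h1 α u hu g hg
  exact this hf

lemma mul_mem_parityPart {i j : ZMod 2} {f g : O F n} (hf : f ∈ parityPart F n i)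
    (hg : g ∈ parityPart F n j) : mul f g ∈ parityPart F n (i + j) := by
  have : parityPart F n i ≤ (parityPart F n (i + j)).comap (mul.flip g) := by
    refine parityPart_induction fun α u hu => ?_
    have : parityPart F n j ≤ (parityPart F n (i + j)).comap (mul (mono α u)) := by
      refine parityPart_induction fun β v hv => ?_
      rw [Submodule.mem_comap, mul_mono]
      split_ifs with h
      · refine Submodule.smul_mem _ _ (mem_parityPart_mono ?_)
        rw [Finset.card_union_of_disjoint h, Nat.cast_add, hu, hv]
      · exact zero_mem _
    exact this hg
  exact this hf

lemma del_inl_mem_parityPart (i : Fin n) {j : ZMod 2} {f : O F n} (hf : f ∈ parityPart F n j) :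
    del (.inl i) f ∈ parityPart F n j := by
  have : parityPart F n j ≤ (parityPart F n j).comap (del (.inl i)) := by
    refine parityPart_induction fun α u hu => ?_
    rw [Submodule.mem_comap, del_inl_mono]
    split_ifs
    · exact zero_mem _
    · exact mem_parityPart_mono hu
  exact this hf

lemma del_inr_mem_parityPart (i : Fin n) {j : ZMod 2} {f : O F n} (hf : f ∈ parityPart F n j) :
    del (.inr i) f ∈ parityPart F n (j + 1) := by
  have : parityPart F n j ≤ (parityPart F n (j + 1)).comap (del (.inr i)) := by
    refine parityPart_induction fun α u hu => ?_
    rw [Submodule.mem_comap, del_inr_mono]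
    split_ifs with h
    · refine Submodule.smul_mem _ _ (mem_parityPart_mono ?_)
      have := Finset.card_erase_add_one h
      rw [← hu, ← this]
      push_cast
      rw [add_assoc, CharTwo.add_self_eq_zero, add_zero]
    · exact zero_mem _
  exact this hf

lemma del_mem_OT {p : ℕ} {t : Fin n → ℕ} (r : Y n) {f : O F n} (hf : f ∈ OT F p t) :
    del r f ∈ OT F p t := by
  have : OT F p t ≤ (OT F p t).comap (del r) := by
    refine OT_induction fun α u hu => ?_
    rw [Submodule.mem_comap]
    rcases r with i | i
    · rw [del_inl_mono]
      split_ifs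
      · exact zero_mem _
      · exact mem_OT_mono fun k => lt_of_le_of_lt (Nat.sub_le _ _) (hu k)
    · rw [del_inr_mono]
      split_ifs
      · exact Submodule.smul_mem _ _ (mem_OT_mono hu)
      · exact zero_mem _
  exact this hf

lemma dvd_choose_of_carry {p : ℕ} (hp : p.Prime) {a b k : ℕ} (ha : a < p ^ k) (hb : b < p ^ k)
    (h : p ^ k ≤ a + b) : p ∣ (a + b).choose a := by
  have hpos : (a + b).choose a ≠ 0 := (Nat.choose_pos (Nat.le_add_right a b)).ne'
  rw [hp.dvd_iff_one_le_factorization hpos, Nat.choose_symm_add, Nat.factorization_choose' hp (Nat.lt_succ_self _),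
    Finset.one_le_card]
  refine ⟨k, ?_⟩
  have hk : k ≠ 0 := by
    rintro rfl
    simp only [pow_zero] at ha hb h
    omega
  simp only [Finset.mem_filter, Finset.mem_Ico]
  refine ⟨⟨Nat.one_le_iff_ne_zero.2 hk, ?_⟩, ?_⟩
  · exact Nat.lt_succ_of_le (Nat.le_log_of_pow_le hp.one_lt (by omega))
  · rw [Nat.mod_eq_of_lt ha, Nat.mod_eq_of_lt hb]
    omega

lemma mul_mem_OT {p : ℕ} [hp : Fact p.Prime] [CharP F p] {t : Fin n → ℕ} {f g : O F n}
    (hf : f ∈ OT F p t) (hg : g ∈ OT F p t) : mul f g ∈ OT F p t := by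
  have : OT F p t ≤ (OT F p t).comap (mul.flip g) := by
    refine OT_induction fun α u hu => ?_
    have : OT F p t ≤ (OT F p t).comap (mul (mono α u)) := by
      refine OT_induction fun β v hv => ?_
      rw [Submodule.mem_comap, mul_mono]
      split_ifs with h
      · by_cases hc : ∀ i, α i + β i < p ^ t i
        · exact Submodule.smul_mem _ _ (mem_OT_mono hc)
        · push Not at hc
          obtain ⟨i, hi⟩ := hc
          have h0 : (binom α β : F) = 0 := by
            rw [CharP.cast_eq_zero_iff F p]
            exact (dvd_choose_of_carry hp.out (hu i) (hv i) hi).trans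
              (Finset.dvd_prod_of_mem _ (Finset.mem_univ i))
          rw [h0, mul_zero, zero_smul]
          exact zero_mem _
      · exact zero_mem _
    exact this hg
  exact this hf

lemma binom_pascal (i : Fin n) (α β : Fin n → ℕ) :
    binom (α + Pi.single i 1) (β + Pi.single i 1) =
      binom α (β + Pi.single i 1) + binom (α + Pi.single i 1) β := by
  simp only [binom, ← Finset.mul_prod_erase Finset.univ _ (Finset.mem_univ i)]
  have e : ∀ α' β' : Fin n → ℕ, (∀ j, j ≠ i → α' j = α j) → (∀ j, j ≠ i → β' j = β j) →
      ∏ j ∈ Finset.univ.erase i, (α' j + β' j).choose (α' j) =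
        ∏ j ∈ Finset.univ.erase i, (α j + β j).choose (α j) := by
    intro α' β' h1 h2
    refine Finset.prod_congr rfl fun j hj => ?_
    rw [h1 j (Finset.ne_of_mem_erase hj), h2 j (Finset.ne_of_mem_erase hj)]
  have ea : ∀ j, j ≠ i → (α + Pi.single i 1 : Fin n → ℕ) j = α j := fun j hj => by
    simp [hj]
  have eb : ∀ j, j ≠ i → (β + Pi.single i 1 : Fin n → ℕ) j = β j := fun j hj => by simp [hj]
  rw [e _ _ ea eb, e _ _ (fun _ _ => rfl) eb, e _ _ ea (fun _ _ => rfl), ← add_mul]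
  congr 1
  simp only [Pi.add_apply, Pi.single_eq_same]
  rw [show α i + 1 + (β i + 1) = (α i + (β i + 1)) + 1 by ring, Nat.choose_succ_succ,
    show α i + 1 + β i = α i + (β i + 1) by ring]

lemma binom_right_of_zero (i : Fin n) (α β : Fin n → ℕ) (h : α i = 0) :
    binom α (β + Pi.single i 1) = binom α β := by
  refine Finset.prod_congr rfl fun j _ => ?_
  by_cases hj : j = i
  · subst hj
    simp [h]
  · simp [hj]

lemma exists_add_single {i : Fin n} {α : Fin n → ℕ} (h : α i ≠ 0) :
    ∃ α' : Fin n → ℕ, α = α' + Pi.single i 1 := by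
  refine ⟨α - Pi.single i 1, funext fun j => ?_⟩
  by_cases hj : j = i
  · subst hj
    simp
    omega
  · simp [hj]

lemma del_inl_mul (i : Fin n) (f g : O F n) :
    del (.inl i) (mul f g) = mul (del (.inl i) f) g + mul f (del (.inl i) g) := by
  have key : (mul : O F n →ₗ[F] O F n →ₗ[F] O F n).compr₂ (del (.inl i)) =
      (mul ∘ₗ del (.inl i)) + (mul.compl₂ (del (.inl i))) := by
    refine ext_mono fun α u => ext_mono fun β v => ?_
    change del (.inl i) (mul (mono α u : O F n) (mono β v)) =
      mul (del (.inl i) (mono α u)) (mono β v) + mul (mono α u) (del (.inl i) (mono β v))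
    have hs : ∀ γ : Fin n → ℕ, γ + Pi.single i 1 - Pi.single i 1 = γ := fun γ => by
      funext j
      simp
    have hn : ∀ γ : Fin n → ℕ, (γ + Pi.single i 1 : Fin n → ℕ) i ≠ 0 := fun γ => by simp
    rw [mul_mono, del_inl_mono, del_inl_mono]
    by_cases huv : Disjoint u v
    swap
    · rw [if_neg huv]
      split_ifs <;> simp [mul_mono, huv]
    rw [if_pos huv, map_smul, del_inl_mono]
    by_cases ha : α i = 0 <;> by_cases hb : β i = 0
    · simp [ha, hb]
    · obtain ⟨β, rfl⟩ := exists_add_single hb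
      rw [if_pos ha, if_neg hb, hs, ← add_assoc, if_neg (hn _), hs, mul_mono, if_pos huv,
        binom_right_of_zero i α β ha]
      simp
    · obtain ⟨α, rfl⟩ := exists_add_single ha
      rw [if_neg ha, if_pos hb, hs, add_right_comm, if_neg (hn _), hs, mul_mono, if_pos huv,
        binom_comm, binom_right_of_zero i β α hb, binom_comm]
      simp
    · obtain ⟨α, rfl⟩ := exists_add_single ha
      obtain ⟨β, rfl⟩ := exists_add_single hb
      rw [if_neg ha, if_neg hb, hs, hs, ← add_assoc, if_neg (hn _), hs, mul_mono, mul_mono,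
        if_pos huv, if_pos huv, binom_pascal, ← add_assoc, add_right_comm α _ β, ← add_smul]
      congr 1
      push_cast
      ring
  exact LinearMap.congr_fun (LinearMap.congr_fun key f) g

lemma sgn_singleton_erase (i : Fin n) (u : Finset (Fin n)) :
    sgn F {i} (u.erase i) = sgn F {i} u := by
  by_cases h : i ∈ u
  · simp [sgn, ← Finset.mul_prod_erase u _ h]
  · rw [Finset.erase_eq_of_notMem h]

lemma sgn_split_left {i : Fin n} {u : Finset (Fin n)} (h : i ∈ u) (v : Finset (Fin n)) :
    sgn F u v = sgn F {i} v * sgn F (u.erase i) v := by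
  simp [sgn, ← Finset.mul_prod_erase u _ h]

lemma sgn_split_right {i : Fin n} {v : Finset (Fin n)} (h : i ∈ v) (u : Finset (Fin n)) :
    sgn F u v = sgn F u {i} * sgn F u (v.erase i) := by
  simp only [sgn, ← Finset.mul_prod_erase v _ h, Finset.prod_mul_distrib, Finset.prod_singleton]

lemma sgn_swap_singleton {i : Fin n} {u : Finset (Fin n)} (h : i ∉ u) :
    sgn F u {i} = (-1) ^ u.card * sgn F {i} u := by
  rw [sgn_comm (by simpa using h)]
  simp

lemma del_inr_mul (i : Fin n) (f g : O F n) :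
    del (.inr i) (mul f g) = mul (del (.inr i) f) g + mul (parityInv f) (del (.inr i) g) := by
  have key : (mul : O F n →ₗ[F] O F n →ₗ[F] O F n).compr₂ (del (.inr i)) =
      (mul ∘ₗ del (.inr i)) + ((mul ∘ₗ parityInv).compl₂ (del (.inr i))) := by
    refine ext_mono fun α u => ext_mono fun β v => ?_
    change del (.inr i) (mul (mono α u : O F n) (mono β v)) =
      mul (del (.inr i) (mono α u)) (mono β v) +
        mul (parityInv (mono α u)) (del (.inr i) (mono β v))
    rw [mul_mono, del_inr_mono, del_inr_mono, parityInv_mono]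
    by_cases hu : i ∈ u <;> by_cases hv : i ∈ v
    · have huv : ¬ Disjoint u v := fun h => Finset.disjoint_left.1 h hu hv
      have h1 : Disjoint (u.erase i) v ↔ Disjoint (u.erase i) (v.erase i) := by
        simp only [Finset.disjoint_left, Finset.mem_erase]
        grind
      have h2 : Disjoint u (v.erase i) ↔ Disjoint (u.erase i) (v.erase i) := by
        simp only [Finset.disjoint_left, Finset.mem_erase]
        grind
      rw [if_neg huv, if_pos hu, if_pos hv, map_zero]
      simp only [map_smul, LinearMap.smul_apply, mul_mono, h1, h2]
      split_ifs with h
      · have e : u.erase i ∪ v = u ∪ v.erase i := by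
          ext j
          simp only [Finset.mem_union, Finset.mem_erase]
          grind
        rw [e, smul_smul, smul_smul, smul_smul, ← add_smul, sgn_split_right hv (u.erase i),
          sgn_split_left hu (v.erase i), sgn_swap_singleton (Finset.notMem_erase i u),
          sgn_singleton_erase, sgn_singleton_erase, ← Finset.card_erase_add_one hu]
        have a1 := sgn_mul_self (F := F) {i} u
        have a2 := sgn_mul_self (F := F) {i} v
        rw [eq_comm]
        convert zero_smul F _
        linear_combination ((-1 : F) ^ (u.erase i).card * sgn F (u.erase i) (v.erase i) *
          (binom α β : F)) * (a1 - a2)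
      · simp
    · have h1 : Disjoint (u.erase i) v ↔ Disjoint u v := by
        simp only [Finset.disjoint_left, Finset.mem_erase]
        grind
      rw [if_pos hu, if_neg hv, map_zero, add_zero, map_smul, LinearMap.smul_apply, mul_mono]
      simp only [h1]
      split_ifs with h
      · rw [map_smul, del_inr_mono, if_pos (Finset.mem_union_left _ hu), Finset.erase_union_distrib,
          Finset.erase_eq_of_notMem hv, smul_smul, smul_smul, sgn_union_right h,
          sgn_split_left hu v]
        congr 1
        linear_combination (sgn F (u.erase i) v * (binom α β : F) * sgn F {i} u) *
          sgn_mul_self (F := F) {i} v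
      · simp
    · have h1 : Disjoint u (v.erase i) ↔ Disjoint u v := by
        simp only [Finset.disjoint_left, Finset.mem_erase]
        grind
      rw [if_neg hu, if_pos hv, map_zero, LinearMap.zero_apply, zero_add]
      simp only [map_smul, LinearMap.smul_apply, mul_mono, h1]
      split_ifs with h
      · rw [map_smul, del_inr_mono, if_pos (Finset.mem_union_right _ hv),
          Finset.erase_union_distrib, Finset.erase_eq_of_notMem hu, smul_smul, smul_smul, smul_smul,
          sgn_union_right h, sgn_split_right hv u, sgn_swap_singleton hu]
        congr 1
        linear_combination ((-1 : F) ^ u.card * sgn F u (v.erase i) * (binom α β : F) *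
          sgn F {i} v) * sgn_mul_self (F := F) {i} u
      · simp
    · rw [if_neg hu, if_neg hv]
      split_ifs with h
      · rw [map_smul, del_inr_mono, if_neg (by simp [hu, hv])]
        simp
      · simp
  exact LinearMap.congr_fun (LinearMap.congr_fun key f) g

lemma del_inl_inl (i j : Fin n) (f : O F n) :
    del (.inl i) (del (.inl j) f) = del (.inl j) (del (.inl i) f) := by
  have key : del (F := F) (.inl i) ∘ₗ del (.inl j) = del (.inl j) ∘ₗ del (.inl i) := by
    refine ext_mono fun α u => ?_
    simp only [LinearMap.comp_apply, del_inl_mono]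
    by_cases hij : i = j
    · rw [hij]
    have hji : j ≠ i := fun h => hij h.symm
    by_cases hi : α i = 0 <;> by_cases hj : α j = 0 <;>
      simp [hi, hj, del_inl_mono, hij, hji, tsub_right_comm]
  exact LinearMap.congr_fun key f

lemma del_inl_inr (i j : Fin n) (f : O F n) :
    del (.inl i) (del (.inr j) f) = del (.inr j) (del (.inl i) f) := by
  have key : del (F := F) (.inl i) ∘ₗ del (.inr j) = del (.inr j) ∘ₗ del (.inl i) := by
    refine ext_mono fun α u => ?_
    simp only [LinearMap.comp_apply, del_inl_mono, del_inr_mono]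
    by_cases hi : α i = 0 <;> by_cases hj : j ∈ u <;>
      simp [hi, hj, del_inl_mono, del_inr_mono]
  exact LinearMap.congr_fun key f

lemma del_inr_inr (i j : Fin n) (f : O F n) :
    del (.inr i) (del (.inr j) f) = - del (.inr j) (del (.inr i) f) := by
  have key : del (F := F) (.inr i) ∘ₗ del (.inr j) =
      - (del (F := F) (.inr j) ∘ₗ del (.inr i)) := by
    refine ext_mono fun α u => ?_
    simp only [LinearMap.comp_apply, LinearMap.neg_apply, del_inr_mono]
    by_cases hij : i = j
    · subst hij
      by_cases hi : i ∈ u <;> simp [hi, del_inr_mono]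
    have hji : j ≠ i := fun h => hij h.symm
    by_cases hi : i ∈ u <;> by_cases hj : j ∈ u <;>
      simp [hi, hj, del_inr_mono, hij, hji]
    rw [smul_smul, smul_smul, Finset.erase_right_comm, ← neg_smul]
    congr 1
    rw [sgn_split_right hj {i}, sgn_split_right hi {j},
      sgn_swap_singleton (F := F) (i := j) (u := {i}) (by simpa using hji)]
    simp
    ring
  exact LinearMap.congr_fun key f

lemma TH_apply (a h : O F n) :
    TH a h = ∑ i : Fin n, (mul (del (.inl i) a) (del (.inr i) h) +
      mul (del (.inr i) (parityInv a)) (del (.inl i) h)) := by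
  simp [TH, Finset.sum_add_distrib, mu]

lemma TH_odd {a : O F n} (ha : a ∈ parityPart F n 1) (h : O F n) :
    TH a h = ∑ i : Fin n, (mul (del (.inl i) a) (del (.inr i) h) -
      mul (del (.inr i) a) (del (.inl i) h)) := by
  rw [TH_apply, parityInv_apply ha]
  refine Finset.sum_congr rfl fun i _ => ?_
  rw [show (1 : ZMod 2).val = 1 from rfl, pow_one, neg_smul, one_smul, map_neg, map_neg,
    LinearMap.neg_apply, sub_eq_add_neg]

lemma TH_even {a : O F n} (ha : a ∈ parityPart F n 0) (h : O F n) :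
    TH a h = ∑ i : Fin n, (mul (del (.inl i) a) (del (.inr i) h) +
      mul (del (.inr i) a) (del (.inl i) h)) := by
  rw [TH_apply, parityInv_apply ha]
  simp

lemma TH_mem_parityPart {i j : ZMod 2} {a h : O F n} (ha : a ∈ parityPart F n i)
    (hh : h ∈ parityPart F n j) : TH a h ∈ parityPart F n (i + j + 1) := by
  rw [TH_apply]
  refine Submodule.sum_mem _ fun k _ => add_mem ?_ ?_
  · have := mul_mem_parityPart (del_inl_mem_parityPart k ha) (del_inr_mem_parityPart k hh)
    rwa [← add_assoc] at this
  · have ha' : parityInv a ∈ parityPart F n i := by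
      rw [parityInv_apply ha]
      exact Submodule.smul_mem _ _ ha
    have := mul_mem_parityPart (del_inr_mem_parityPart k ha') (del_inl_mem_parityPart k hh)
    rwa [add_right_comm] at this

lemma TH_mul {a f : O F n} (ha : a ∈ parityPart F n 1) {j : ZMod 2} (hf : f ∈ parityPart F n j)
    (g : O F n) : TH a (mul f g) = mul (TH a f) g + mul f (TH a g) := by
  simp only [TH_odd ha, map_sum, LinearMap.sum_apply]
  rw [← Finset.sum_add_distrib]
  refine Finset.sum_congr rfl fun i _ => ?_
  have h1 : mul (del (.inl i) a) (parityInv f) = mul f (del (.inl i) a) := by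
    rw [parityInv_apply hf, map_smul, mul_comm_parity (del_inl_mem_parityPart i ha) hf, smul_smul,
      show (1 : ZMod 2).val = 1 from rfl, one_mul, ← mul_pow]
    simp
  have h2 : mul (del (.inr i) a) f = mul f (del (.inr i) a) := by
    rw [mul_comm_parity (del_inr_mem_parityPart i ha) hf, show (1 + 1 : ZMod 2).val = 0 from rfl]
    simp
  rw [del_inl_mul, del_inr_mul]
  simp only [map_add, map_sub, LinearMap.sub_apply, ← mul_assoc', h1, h2]
  abel

lemma del_TH_inl {a : O F n} (ha : a ∈ parityPart F n 1) (r : Fin n) (h : O F n) :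
    del (.inl r) (TH a h) = TH a (del (.inl r) h) + TH (del (.inl r) a) h := by
  rw [TH_odd ha, TH_odd ha, TH_odd (del_inl_mem_parityPart r ha), map_sum,
    ← Finset.sum_add_distrib]
  refine Finset.sum_congr rfl fun i _ => ?_
  rw [map_sub, del_inl_mul, del_inl_mul, del_inl_inl r i a, del_inl_inl r i h,
    del_inl_inr r i a, del_inl_inr r i h]
  abel

lemma del_TH_inr {a : O F n} (ha : a ∈ parityPart F n 1) (r : Fin n) (h : O F n) :
    del (.inr r) (TH a h) = TH a (del (.inr r) h) + TH (del (.inr r) a) h := by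
  have h0 : (1 + 1 : ZMod 2) = 0 := rfl
  rw [TH_odd ha, TH_odd ha, TH_even (h0 ▸ del_inr_mem_parityPart r ha), map_sum,
    ← Finset.sum_add_distrib]
  refine Finset.sum_congr rfl fun i _ => ?_
  rw [map_sub, del_inr_mul, del_inr_mul, parityInv_apply (del_inl_mem_parityPart i ha),
    parityInv_apply (del_inr_mem_parityPart i ha), h0, del_inr_inr r i a, del_inr_inr r i h,
    ← del_inl_inr i r a, ← del_inl_inr i r h, show (1 : ZMod 2).val = 1 from rfl,
    show (0 : ZMod 2).val = 0 from rfl, del_inl_inr i r a]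
  simp only [pow_one, pow_zero, neg_smul, one_smul, map_neg, LinearMap.neg_apply]
  abel

lemma TH_bracket {a b : O F n} (ha : a ∈ parityPart F n 1) (hb : b ∈ parityPart F n 1) :
    ⁅TH a, TH b⁆ = TH (TH a b) := by
  have h0 : (1 + 1 : ZMod 2) = 0 := rfl
  have hab : TH a b ∈ parityPart F n 1 := by
    have := TH_mem_parityPart ha hb
    rwa [h0, zero_add] at this
  refine LinearMap.ext fun h => ?_
  have hL : TH a (TH b h) = ∑ i : Fin n,
      (mul (TH a (del (.inl i) b)) (del (.inr i) h) + mul (del (.inl i) b) (TH a (del (.inr i) h)) -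
        (mul (TH a (del (.inr i) b)) (del (.inl i) h) +
          mul (del (.inr i) b) (TH a (del (.inl i) h)))) := by
    rw [TH_odd hb, map_sum]
    refine Finset.sum_congr rfl fun i _ => ?_
    rw [map_sub, TH_mul ha (del_inl_mem_parityPart i hb), TH_mul ha (del_inr_mem_parityPart i hb)]
  have hR : TH b (TH a h) = ∑ i : Fin n,
      (mul (del (.inl i) b) (TH a (del (.inr i) h) + TH (del (.inr i) a) h) -
        mul (del (.inr i) b) (TH a (del (.inl i) h) + TH (del (.inl i) a) h)) := by
    rw [TH_odd hb]
    refine Finset.sum_congr rfl fun i _ => ?_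
    rw [del_TH_inl ha, del_TH_inr ha]
  have hE : TH (TH a b) h = ∑ i : Fin n,
      (mul (TH a (del (.inl i) b) + TH (del (.inl i) a) b) (del (.inr i) h) -
        mul (TH a (del (.inr i) b) + TH (del (.inr i) a) b) (del (.inl i) h)) := by
    rw [TH_odd hab]
    refine Finset.sum_congr rfl fun i _ => ?_
    rw [del_TH_inl ha, del_TH_inr ha]
  have hS : ∑ i : Fin n, (mul (del (.inr i) b) (TH (del (.inl i) a) h) -
        mul (del (.inl i) b) (TH (del (.inr i) a) h)) =
      ∑ i : Fin n, (mul (TH (del (.inl i) a) b) (del (.inr i) h) -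
        mul (TH (del (.inr i) a) b) (del (.inl i) h)) := by
    have e1 : ∀ i : Fin n, mul (del (.inr i) b) (TH (del (.inl i) a) h) -
          mul (del (.inl i) b) (TH (del (.inr i) a) h) =
        ∑ j : Fin n,
          (mul (mul (del (.inl j) (del (.inl i) a)) (del (.inr i) b)) (del (.inr j) h) -
            mul (mul (del (.inr j) (del (.inl i) a)) (del (.inr i) b)) (del (.inl j) h) -
            mul (mul (del (.inl j) (del (.inr i) a)) (del (.inl i) b)) (del (.inr j) h) +
            mul (mul (del (.inr j) (del (.inr i) a)) (del (.inl i) b)) (del (.inl j) h)) := by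
      intro i
      have p1 := del_inl_mem_parityPart i ha
      have p2 : del (.inr i) a ∈ parityPart F n 0 := h0 ▸ del_inr_mem_parityPart i ha
      have q1 := del_inl_mem_parityPart i hb
      have q2 : del (.inr i) b ∈ parityPart F n 0 := h0 ▸ del_inr_mem_parityPart i hb
      rw [TH_odd p1, TH_even p2, map_sum, map_sum, ← Finset.sum_sub_distrib]
      refine Finset.sum_congr rfl fun j _ => ?_
      rw [map_sub, map_add, ← mul_assoc', ← mul_assoc', ← mul_assoc', ← mul_assoc',
        mul_comm_parity q2 (del_inl_mem_parityPart j p1),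
        mul_comm_parity q2 (del_inr_mem_parityPart j p1),
        mul_comm_parity q1 (del_inl_mem_parityPart j p2),
        mul_comm_parity q1 (del_inr_mem_parityPart j p2), h0, zero_add,
        show (1 : ZMod 2).val = 1 from rfl, show (0 : ZMod 2).val = 0 from rfl]
      simp only [mul_zero, mul_one, pow_one, pow_zero, neg_smul, one_smul, map_neg,
        LinearMap.neg_apply]
      abel
    have e2 : ∀ i : Fin n, mul (TH (del (.inl i) a) b) (del (.inr i) h) -
          mul (TH (del (.inr i) a) b) (del (.inl i) h) =
        ∑ j : Fin n,
          (mul (mul (del (.inl j) (del (.inl i) a)) (del (.inr j) b)) (del (.inr i) h) -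
            mul (mul (del (.inr j) (del (.inl i) a)) (del (.inl j) b)) (del (.inr i) h) -
            mul (mul (del (.inl j) (del (.inr i) a)) (del (.inr j) b)) (del (.inl i) h) -
            mul (mul (del (.inr j) (del (.inr i) a)) (del (.inl j) b)) (del (.inl i) h)) := by
      intro i
      have p2 : del (.inr i) a ∈ parityPart F n 0 := h0 ▸ del_inr_mem_parityPart i ha
      rw [TH_odd (del_inl_mem_parityPart i ha), TH_even p2, map_sum, map_sum,
        LinearMap.sum_apply, LinearMap.sum_apply, ← Finset.sum_sub_distrib]
      refine Finset.sum_congr rfl fun j _ => ?_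
      simp only [map_sub, map_add, LinearMap.sub_apply, LinearMap.add_apply]
      abel
    rw [Finset.sum_congr rfl fun i _ => e1 i, Finset.sum_congr rfl fun i _ => e2 i,
      Finset.sum_comm]
    refine Finset.sum_congr rfl fun i _ => Finset.sum_congr rfl fun j _ => ?_
    rw [del_inl_inl i j a, del_inr_inr i j a, del_inl_inr i j a, ← del_inl_inr j i a]
    simp only [map_neg, LinearMap.neg_apply]
    abel
  have hLR : TH a (TH b h) - TH b (TH a h) = ∑ i : Fin n,
      (mul (TH a (del (.inl i) b)) (del (.inr i) h) -
        mul (TH a (del (.inr i) b)) (del (.inl i) h)) +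
      ∑ i : Fin n, (mul (del (.inr i) b) (TH (del (.inl i) a) h) -
        mul (del (.inl i) b) (TH (del (.inr i) a) h)) := by
    rw [hL, hR, ← Finset.sum_sub_distrib, ← Finset.sum_add_distrib]
    refine Finset.sum_congr rfl fun i _ => ?_
    simp only [map_add]
    abel
  change TH a (TH b h) - TH b (TH a h) = TH (TH a b) h
  rw [hLR, hS, hE, ← Finset.sum_add_distrib]
  refine Finset.sum_congr rfl fun i _ => ?_
  simp only [map_add, LinearMap.add_apply]
  abel

lemma parityPart_disjoint {j : ZMod 2} {f : O F n} (h₁ : f ∈ parityPart F n j)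
    (h₂ : f ∈ parityPart F n (j + 1)) : f = 0 := by
  ext x
  by_contra hx
  have m1 : ((x.2.card : ℕ) : ZMod 2) = j := h₁ (Finsupp.mem_support_iff.2 hx)
  have m2 : ((x.2.card : ℕ) : ZMod 2) = j + 1 := h₂ (Finsupp.mem_support_iff.2 hx)
  rw [m1] at m2
  simp at m2

/-- An even element of `HO(n,n;t)` is `T_H(a)` with `a` odd, as `T_H` is odd. -/
lemma exists_odd_of_mem {p : ℕ} {t : Fin n → ℕ} {D : Module.End F (O F n)}
    (hD : D ∈ HO F p t) (hD' : D ∈ evenEnd F n) :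
    ∃ a ∈ OT F p t, a ∈ parityPart F n 1 ∧ TH a = D := by
  classical
  obtain ⟨a, ha, rfl⟩ := hD
  have hz : ∀ c : ZMod 2, c ≠ 1 → c = 0 := by decide
  have hsum := Finsupp.filter_add_filter_not a
    (fun x : (Fin n → ℕ) × Finset (Fin n) => ((x.2.card : ℕ) : ZMod 2) = 1)
  set a₁ := a.filter fun x : (Fin n → ℕ) × Finset (Fin n) => ((x.2.card : ℕ) : ZMod 2) = 1
  set a₀ := a.filter fun x : (Fin n → ℕ) × Finset (Fin n) => ¬ ((x.2.card : ℕ) : ZMod 2) = 1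
  have h1 : a₁ ∈ parityPart F n 1 := fun x hx => (Finset.mem_filter.1 hx).2
  have h0 : a₀ ∈ parityPart F n 0 := fun x hx =>
    hz _ (Finset.mem_filter.1 hx).2
  have hT : a₁ ∈ OT F p t := fun x hx => ha (Finset.mem_filter.1 hx).1
  refine ⟨a₁, hT, h1, ?_⟩
  have hzero : TH a₀ = 0 := by
    refine ext_mono fun α u => ?_
    have hm := mem_parityPart_mono (F := F) (α := α) (u := u) rfl
    have e1 := TH_mem_parityPart h0 hm
    have e2 := TH_mem_parityPart h1 hm
    have e3 := hD' _ _ hm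
    rw [← hsum, map_add, LinearMap.add_apply] at e3
    rw [show (1 : ZMod 2) + (u.card : ZMod 2) + 1 = u.card by
      rw [add_right_comm, show (1 + 1 : ZMod 2) = 0 from rfl, zero_add]] at e2
    rw [zero_add] at e1
    exact parityPart_disjoint ((Submodule.add_mem_iff_right _ e2).1 e3) e1
  rw [← hsum, map_add, hzero, add_zero]

lemma TH_mem_OT {p : ℕ} [Fact p.Prime] [CharP F p] {t : Fin n → ℕ} {a b : O F n}
    (ha : a ∈ OT F p t) (ha' : a ∈ parityPart F n 1) (hb : b ∈ OT F p t) : TH a b ∈ OT F p t := by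
  rw [TH_odd ha']
  exact Submodule.sum_mem _ fun i _ => sub_mem (mul_mem_OT (del_mem_OT _ ha) (del_mem_OT _ hb))
    (mul_mem_OT (del_mem_OT _ ha) (del_mem_OT _ hb))

/-- The Lie algebra `𝓗𝓞`, the even part of `HO(n,n;t)`; on even operators the bracket of the
superalgebra is the commutator. -/
noncomputable def HOeven (F : Type*) [Field F] (p : ℕ) [Fact p.Prime] [CharP F p] {n : ℕ}
    (t : Fin n → ℕ) : LieSubalgebra F (Module.End F (O F n)) where
  __ := HO F p t ⊓ evenEnd F n
  lie_mem' := by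
    rintro D E ⟨hD, hD'⟩ ⟨hE, hE'⟩
    refine ⟨?_, fun j f hf => ?_⟩
    · obtain ⟨a, ha, ha', rfl⟩ := exists_odd_of_mem hD hD'
      obtain ⟨b, hb, hb', rfl⟩ := exists_odd_of_mem hE hE'
      rw [TH_bracket ha' hb']
      exact ⟨_, TH_mem_OT ha ha' hb, rfl⟩
    · exact sub_mem (hD' j _ (hE' j f hf)) (hE' j _ (hD' j f hf))

/-! ### Derivations of `𝓗𝓞`

All spaces of maps below are subspaces of the linear maps from `𝓗𝓞` to the operators on `𝒪(n,n)`. -/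

variable (F) (p : ℕ) [Fact p.Prime] [CharP F p] (t : Fin n → ℕ)

/-- The derivation algebra `Der(𝓗𝓞)`; a derivation is composed with the inclusion of `𝓗𝓞`. -/
noncomputable def derHO : Submodule F (HOeven F p t →ₗ[F] Module.End F (O F n)) where
  carrier := {ψ | ∃ φ : LieDerivation F (HOeven F p t) (HOeven F p t), ∀ E, ψ E = φ E}
  add_mem' := by
    rintro _ _ ⟨φ₁, h₁⟩ ⟨φ₂, h₂⟩
    exact ⟨φ₁ + φ₂, fun E => by simp [h₁, h₂]⟩
  zero_mem' := ⟨0, fun E => by simp⟩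
  smul_mem' := by
    rintro c _ ⟨φ, h⟩
    exact ⟨c • φ, fun E => by simp [h]⟩

/-- Restriction to `𝓗𝓞` of a linear endomorphism of the space of operators on `𝒪(n,n)`. -/
noncomputable def restrictHO : Module.End F (Module.End F (O F n)) →ₗ[F]
    (HOeven F p t →ₗ[F] Module.End F (O F n)) :=
  LinearMap.lcomp F (Module.End F (O F n)) (HOeven F p t).toSubmodule.subtype

/-- `ad(𝓗𝓞 + 𝔽 Γ)`. -/
noncomputable def adHOGam : Submodule F (HOeven F p t →ₗ[F] Module.End F (O F n)) :=
  ((HOeven F p t).toSubmodule ⊔ Submodule.span F {Gam F n}).map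
    (restrictHO F p t ∘ₗ (LieAlgebra.ad F (Module.End F (O F n))).toLinearMap)

/-- The span of the `(ad ∂_i)^{p^k}`, `i ∈ Y₀`, `1 ≤ k < t_i`. -/
noncomputable def adPowers : Submodule F (HOeven F p t →ₗ[F] Module.End F (O F n)) :=
  Submodule.span F {ψ | ∃ (i : Fin n) (k : ℕ), 1 ≤ k ∧ k < t i ∧
    ψ = restrictHO F p t (LieAlgebra.ad F (Module.End F (O F n)) (del (.inl i)) ^ p ^ k)}

end

end OddHamiltonian

/-!
Brackets satisfy `[T_H(a), T_H(b)] = T_H(T_H(a)(b))` for odd `a`, `b`, so `𝓗𝓞` is the odd part of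
`𝒪(n,n;t)` with the bracket `{a, b} = T_H(a)(b)`, and a derivation of `𝓗𝓞` becomes an operator `Φ`
on that space. Since `∂_i` acts as `-{x_{i'}, ·}`, the images `Φ(x_{i'})` form a closed system, and
the Poincaré lemma for truncated divided powers makes `Φ` commute with the `∂_i` after subtracting
an inner derivation; the first cohomology of the torus spanned by the `x_i x_{i'}` allows the same
for the torus. What remains preserves weights and commutes with the `∂_i`. On the elements
`f x_{i'}`, which form a copy of the Witt algebra, such a `Φ` is determined by the coefficients of
`x_{i'}` in `Φ(x_i^(p^k) x_{i'})`, and these are removed by subtracting multiples of the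
`∂_i^{p^k}`. A `Φ` that kills all the `f x_{i'}` scales each `x^(α) x^u` by a factor that depends
only on `u`, and the bracket of `x_i x^v` with `x^u` shows that this factor is proportional to
`|u| - 1`, the eigenvalue of `ad Γ`.
-/

namespace OddHamiltonian

section

variable {F : Type*} [Field F] {n : ℕ}

attribute [local instance] LieRing.ofAssociativeRing

variable {p : ℕ} {t : Fin n → ℕ}

/-! ### Coefficients -/

lemma mono_apply (α β : Fin n → ℕ) (u v : Finset (Fin n)) :
    (mono α u : O F n) (β, v) = if α = β ∧ u = v then 1 else 0 := by
  classical
  simp [mono, Finsupp.single_apply]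

lemma sub_single_add {γ : Fin n → ℕ} {i : Fin n} (h : γ i ≠ 0) :
    γ - Pi.single i 1 + Pi.single i 1 = γ := by
  obtain ⟨γ, rfl⟩ := exists_add_single h
  rw [add_tsub_cancel_right]

lemma del_inl_apply (i : Fin n) (f : O F n) (γ : Fin n → ℕ) (w : Finset (Fin n)) :
    del (.inl i) f (γ, w) = f (γ + Pi.single i 1, w) := by
  have key : Finsupp.lapply (R := F) (γ, w) ∘ₗ del (F := F) (.inl i) =
      Finsupp.lapply (γ + Pi.single i 1, w) := by
    refine ext_mono fun α u => ?_
    simp only [LinearMap.comp_apply, Finsupp.lapply_apply, del_inl_mono]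
    split_ifs with h
    · rw [mono_apply, if_neg]
      · rfl
      · rintro ⟨rfl, -⟩
        simp at h
    · obtain ⟨α, rfl⟩ := exists_add_single h
      simp [mono_apply]
  exact LinearMap.congr_fun key f

lemma del_inl_pow_apply (i : Fin n) (m : ℕ) (f : O F n) (γ : Fin n → ℕ) (w : Finset (Fin n)) :
    (del (.inl i) ^ m) f (γ, w) = f (γ + Pi.single i m, w) := by
  induction m generalizing f with
  | zero => simp
  | succ m ih =>
    rw [pow_succ, Module.End.mul_apply, ih, del_inl_apply, add_assoc, ← Pi.single_add]

lemma del_inl_mono_add (i : Fin n) (α : Fin n → ℕ) (u : Finset (Fin n)) :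
    del (.inl i) (mono (α + Pi.single i 1) u : O F n) = mono α u := by
  simp [del_inl_mono]

lemma apply_eq_zero_of_del_inl {f : O F n} (hf : ∀ i, del (.inl i) f = 0) {γ : Fin n → ℕ}
    (hγ : γ ≠ 0) (w : Finset (Fin n)) : f (γ, w) = 0 := by
  obtain ⟨i, hi⟩ := Function.ne_iff.1 hγ
  rw [← sub_single_add hi, ← del_inl_apply, hf i, Finsupp.zero_apply]

lemma odd_card_of_apply_ne_zero {a : O F n} (ha : a ∈ parityPart F n 1) {γ : Fin n → ℕ}
    {w : Finset (Fin n)} (hw : a (γ, w) ≠ 0) : Odd w.card :=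
  (ZMod.natCast_eq_one_iff_odd).1 (ha (Finsupp.mem_support_iff.2 hw))

lemma mono_mem_parityPart_one {α : Fin n → ℕ} {u : Finset (Fin n)} (hu : Odd u.card) :
    (mono α u : O F n) ∈ parityPart F n 1 :=
  mem_parityPart_mono ((ZMod.natCast_eq_one_iff_odd).2 hu)

lemma mono_singleton_mem_parityPart_one (α : Fin n → ℕ) (i : Fin n) :
    (mono α {i} : O F n) ∈ parityPart F n 1 :=
  mono_mem_parityPart_one (by simp)

/-! ### Brackets of monomials -/

lemma binom_zero_left (β : Fin n → ℕ) : binom 0 β = 1 := by simp [binom]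

lemma binom_single_left (i : Fin n) (a : ℕ) (β : Fin n → ℕ) :
    binom (Pi.single i a) β = (a + β i).choose a := by
  rw [binom, Finset.prod_eq_single i]
  · simp
  · intro j _ hj
    simp [hj]
  · simp

lemma sgn_ne_zero (u v : Finset (Fin n)) : sgn F u v ≠ 0 :=
  left_ne_zero_of_mul_eq_one (sgn_mul_self u v)

lemma mul_mono_empty (α β : Fin n → ℕ) (u : Finset (Fin n)) :
    mul (mono α ∅ : O F n) (mono β u) = (binom α β : F) • mono (α + β) u := by
  simp [mul_mono, sgn]

lemma mul_mono_del_inr_mono (i : Fin n) (γ β : Fin n → ℕ) (u : Finset (Fin n)) :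
    mul (mono γ {i} : O F n) (del (.inr i) (mono β u)) =
      if i ∈ u then (binom γ β : F) • mono (γ + β) u else 0 := by
  rw [del_inr_mono]
  split_ifs with hi
  · have hd : Disjoint {i} (u.erase i) := by simp
    rw [map_smul, mul_mono, if_pos hd, sgn_singleton_erase, smul_smul, ← mul_assoc, sgn_mul_self,
      one_mul, ← Finset.insert_eq, Finset.insert_erase hi]
  · rw [map_zero]

lemma TH_mono_singleton (γ : Fin n → ℕ) (i : Fin n) (h : O F n) :
    TH (mono γ {i}) h = (∑ l : Fin n, if γ l = 0 then 0 else
        mul (mono (γ - Pi.single l 1) {i}) (del (.inr l) h)) -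
      mul (mono γ ∅) (del (.inl i) h) := by
  rw [TH_odd (mono_singleton_mem_parityPart_one γ i), Finset.sum_sub_distrib]
  congr 1
  · refine Finset.sum_congr rfl fun l _ => ?_
    rw [del_inl_mono]
    split_ifs <;> simp
  · rw [Finset.sum_eq_single i]
    · simp [del_inr_mono, sgn]
    · intro l _ hl
      simp [del_inr_mono, hl]
    · simp

lemma TH_mono_zero (i : Fin n) (h : O F n) : TH (mono 0 {i}) h = - del (.inl i) h := by
  have one_mul : mul (mono 0 ∅ : O F n) = LinearMap.id :=
    ext_mono fun α u => by simp [mul_mono_empty, binom_zero_left]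
  simp [TH_mono_singleton, one_mul]

lemma TH_mono_single_mono (i : Fin n) (a : ℕ) (β : Fin n → ℕ) (u : Finset (Fin n)) :
    TH (mono (Pi.single i (a + 1)) {i} : O F n) (mono β u) =
      ((if i ∈ u then ((a + β i).choose a : F) else 0) - ((a + β i).choose (a + 1) : F)) •
        mono (β + Pi.single i a) u := by
  have hsub : (Pi.single i (a + 1) - Pi.single i 1 : Fin n → ℕ) = Pi.single i a := by
    rw [Pi.single_add, add_tsub_cancel_right]
  rw [TH_mono_singleton, sub_smul, Finset.sum_eq_single i]
  · congr 1
    · simp [hsub, mul_mono_del_inr_mono, binom_single_left, add_comm β, ite_smul]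
    · by_cases h : β i = 0
      · simp [del_inl_mono, h]
      · obtain ⟨β, rfl⟩ := exists_add_single h
        rw [del_inl_mono_add, mul_mono_empty, binom_single_left, Pi.single_add]
        congr 2
        · simp [add_assoc, add_comm 1]
        · abel
  · intro l _ hl
    simp [hl]
  · simp

lemma TH_mono_single_one_mono_zero {i : Fin n} {u v : Finset (Fin n)} (hi : i ∈ u)
    (hv : Odd v.card) (huv : Disjoint v (u.erase i)) :
    TH (mono (Pi.single i 1) v : O F n) (mono 0 u) =
      (sgn F {i} u * sgn F v (u.erase i)) • mono 0 (v ∪ u.erase i) := by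
  rw [TH_odd (mono_mem_parityPart_one hv), Finset.sum_eq_single i]
  · simp [del_inl_mono, del_inr_mono, hi, mul_mono, huv, binom_zero_left, smul_smul]
  · intro l _ hl
    simp [del_inl_mono, hl]
  · simp

lemma TH_antisymm {a b : O F n} (ha : a ∈ parityPart F n 1) (hb : b ∈ parityPart F n 1) :
    TH a b = - TH b a := by
  rw [TH_odd ha, TH_odd hb, ← Finset.sum_neg_distrib]
  refine Finset.sum_congr rfl fun i _ => ?_
  have h0 : (1 + 1 : ZMod 2).val = 0 := rfl
  rw [mul_comm_parity (del_inl_mem_parityPart i ha) (del_inr_mem_parityPart i hb),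
    mul_comm_parity (del_inr_mem_parityPart i ha) (del_inl_mem_parityPart i hb), h0]
  simp

lemma TH_apply_mono_zero {a : O F n} (ha : a ∈ parityPart F n 1) (i : Fin n) :
    TH a (mono 0 {i}) = del (.inl i) a := by
  rw [TH_antisymm ha (mono_singleton_mem_parityPart_one 0 i), TH_mono_zero, neg_neg]

lemma lie_eq_iff_forall_apply {R M : Type*} [CommRing R] [AddCommGroup M] [Module R M]
    {D E K : Module.End R M} : ⁅D, E⁆ = K ↔ ∀ x, D (E x) = K x + E (D x) := by
  simp [Ring.lie_def, LinearMap.ext_iff, sub_eq_iff_eq_add]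

lemma TH_jacobi {a b : O F n} (ha : a ∈ parityPart F n 1) (hb : b ∈ parityPart F n 1) (h : O F n) :
    TH a (TH b h) = TH (TH a b) h + TH b (TH a h) :=
  lie_eq_iff_forall_apply.1 (TH_bracket ha hb) h

/-! ### The torus -/

/-- The generating functions `x_i x_{i'}` of the standard torus of `𝓗𝓞`; together with the `∂_i`
this torus has zero centralizer, which is how derivations are told apart. -/
noncomputable def torus (F : Type*) [Field F] (i : Fin n) : O F n := mono (Pi.single i 1) {i}

/-- The eigenvalue of `torus i` on `x^(α) x^u`. -/
def weight (F : Type*) [Field F] (α : Fin n → ℕ) (u : Finset (Fin n)) (i : Fin n) : F :=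
  (if i ∈ u then 1 else 0) - α i

lemma torus_mem_parityPart_one (i : Fin n) : torus F i ∈ parityPart F n 1 :=
  mono_singleton_mem_parityPart_one _ i

lemma TH_torus_mono (i : Fin n) (α : Fin n → ℕ) (u : Finset (Fin n)) :
    TH (torus F i) (mono α u) = weight F α u i • mono α u := by
  simpa [torus, weight] using TH_mono_single_mono i 0 α u

lemma TH_torus_apply (i : Fin n) (f : O F n) (γ : Fin n → ℕ) (w : Finset (Fin n)) :
    TH (torus F i) f (γ, w) = weight F γ w i * f (γ, w) := by
  have key : Finsupp.lapply (R := F) (γ, w) ∘ₗ TH (torus F i) =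
      weight F γ w i • Finsupp.lapply (γ, w) := by
    refine ext_mono fun α u => ?_
    by_cases h : α = γ ∧ u = w
    · obtain ⟨rfl, rfl⟩ := h
      simp [TH_torus_mono]
    · simp [TH_torus_mono, mono_apply, h]
  exact LinearMap.congr_fun key f

lemma TH_apply_torus {a : O F n} (ha : a ∈ parityPart F n 1) (i : Fin n) :
    TH a (torus F i) = - TH (torus F i) a :=
  TH_antisymm ha (torus_mem_parityPart_one i)

lemma eq_zero_of_del_of_torus {a : O F n} (ha : a ∈ parityPart F n 1)
    (h₁ : ∀ i, del (.inl i) a = 0) (h₂ : ∀ i, TH (torus F i) a = 0) : a = 0 := by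
  by_contra h
  obtain ⟨⟨γ, w⟩, hne⟩ := Finsupp.ne_iff.1 h
  obtain rfl : γ = 0 := by
    by_contra hγ
    exact hne (apply_eq_zero_of_del_inl h₁ hγ w)
  obtain ⟨i, hi⟩ := Finset.card_pos.1 (odd_card_of_apply_ne_zero ha hne).pos
  have := TH_torus_apply i a 0 w
  rw [h₂ i] at this
  exact hne (by simpa [weight, hi] using this.symm)

/-! ### The odd part of `𝒪(n,n;t)` and its derivations -/

/-- The exponents `α` of the monomials `x^(α) x^u` in `𝒪(n,n;t)`. -/
def box (p : ℕ) (t : Fin n → ℕ) : Set (Fin n → ℕ) := {α | ∀ i, α i < p ^ t i}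

lemma zero_mem_box [hp : Fact p.Prime] : 0 ∈ box p t := fun _ => pow_pos hp.out.pos _

lemma single_mem_box [hp : Fact p.Prime] {i : Fin n} {m : ℕ} (hm : m < p ^ t i) :
    Pi.single i m ∈ box p t := fun j => by
  obtain rfl | h := eq_or_ne j i
  · simpa using hm
  · simpa [h] using pow_pos hp.out.pos _

lemma single_one_mem_box [hp : Fact p.Prime] (ht : ∀ i, 1 ≤ t i) (i : Fin n) :
    Pi.single i 1 ∈ box p t :=
  single_mem_box (Nat.one_lt_pow (Nat.one_le_iff_ne_zero.1 (ht i)) hp.out.one_lt)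

lemma mem_box_of_le {α β : Fin n → ℕ} (hαβ : α ≤ β) (hβ : β ∈ box p t) : α ∈ box p t :=
  fun i => (hαβ i).trans_lt (hβ i)

/-- The odd part of `𝒪(n,n;t)`, which `T_H` identifies with `𝓗𝓞`. -/
noncomputable def oddOT (F : Type*) [Field F] (p : ℕ) (t : Fin n → ℕ) : Submodule F (O F n) :=
  OT F p t ⊓ parityPart F n 1

lemma mono_mem_oddOT {α : Fin n → ℕ} {u : Finset (Fin n)} (hα : α ∈ box p t) (hu : Odd u.card) :
    (mono α u : O F n) ∈ oddOT F p t :=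
  ⟨mem_OT_mono hα, mono_mem_parityPart_one hu⟩

lemma mono_singleton_mem_oddOT {α : Fin n → ℕ} (hα : α ∈ box p t) (i : Fin n) :
    (mono α {i} : O F n) ∈ oddOT F p t :=
  mono_mem_oddOT hα (by simp)

lemma torus_mem_oddOT [Fact p.Prime] (ht : ∀ i, 1 ≤ t i) (i : Fin n) :
    torus F i ∈ oddOT F p t :=
  mono_singleton_mem_oddOT (single_one_mem_box ht i) i

lemma mem_box_of_apply_ne_zero {a : O F n} (ha : a ∈ oddOT F p t) {γ : Fin n → ℕ}
    {w : Finset (Fin n)} (h : a (γ, w) ≠ 0) : γ ∈ box p t :=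
  ha.1 (Finsupp.mem_support_iff.2 h)

lemma mem_oddOT_of_forall {a : O F n} (h : ∀ γ w, a (γ, w) ≠ 0 → γ ∈ box p t ∧ Odd w.card) :
    a ∈ oddOT F p t :=
  ⟨fun _ hx => (h _ _ (Finsupp.mem_support_iff.1 hx)).1,
    fun _ hx => (ZMod.natCast_eq_one_iff_odd).2 (h _ _ (Finsupp.mem_support_iff.1 hx)).2⟩

lemma oddOT_le {P : Submodule F (O F n)}
    (h : ∀ α ∈ box p t, ∀ u : Finset (Fin n), Odd u.card → mono α u ∈ P) : oddOT F p t ≤ P := by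
  rw [oddOT, OT, parityPart, ← Finsupp.supported_inter, Finsupp.supported_eq_span_single,
    Submodule.span_le]
  rintro _ ⟨⟨α, u⟩, hu, rfl⟩
  exact h α hu.1 u (ZMod.natCast_eq_one_iff_odd.1 hu.2)

lemma eqOn_oddOT {M : Type*} [AddCommGroup M] [Module F M] {Φ Ψ : O F n →ₗ[F] M}
    (h : ∀ α ∈ box p t, ∀ u : Finset (Fin n), Odd u.card → Φ (mono α u) = Ψ (mono α u)) :
    Set.EqOn Φ Ψ (oddOT F p t) :=
  oddOT_le (P := LinearMap.eqLocus Φ Ψ) h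

lemma del_inl_pow_mem_parityPart (i : Fin n) (m : ℕ) {j : ZMod 2} {a : O F n}
    (ha : a ∈ parityPart F n j) : (del (.inl i) ^ m) a ∈ parityPart F n j :=
  Module.End.pow_apply_mem_of_forall_mem m (fun _ => del_inl_mem_parityPart i) a ha

lemma del_inl_mem_oddOT (i : Fin n) {a : O F n} (ha : a ∈ oddOT F p t) :
    del (.inl i) a ∈ oddOT F p t :=
  ⟨del_mem_OT _ ha.1, del_inl_mem_parityPart i ha.2⟩

lemma del_inl_pow_mem_oddOT (i : Fin n) (m : ℕ) {a : O F n} (ha : a ∈ oddOT F p t) :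
    (del (.inl i) ^ m) a ∈ oddOT F p t :=
  Module.End.pow_apply_mem_of_forall_mem m (fun _ => del_inl_mem_oddOT i) a ha

lemma TH_mem_oddOT [Fact p.Prime] [CharP F p] {a b : O F n} (ha : a ∈ oddOT F p t)
    (hb : b ∈ oddOT F p t) : TH a b ∈ oddOT F p t :=
  ⟨TH_mem_OT ha.1 ha.2 hb.1, by simpa [CharTwo.add_self_eq_zero] using TH_mem_parityPart ha.2 hb.2⟩

lemma eq_zero_of_forall_TH_eq_zero [hp : Fact p.Prime] (ht : ∀ i, 1 ≤ t i) {a : O F n}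
    (ha : a ∈ parityPart F n 1) (h : ∀ b ∈ oddOT F p t, TH a b = 0) : a = 0 := by
  refine eq_zero_of_del_of_torus ha (fun i => ?_) fun i => ?_
  · rw [← TH_apply_mono_zero ha, h _ (mono_singleton_mem_oddOT zero_mem_box i)]
  · rw [← neg_eq_zero, ← TH_apply_torus ha, h _ (torus_mem_oddOT ht i)]

/-- The operators on `𝒪(n,n)` that restrict to a derivation of the odd part of `𝒪(n,n;t)` with the
bracket `{a, b} = T_H(a)(b)`. Such an operator matters only through its values on `oddOT`, and
statements about it are stated there. -/
noncomputable def oddDer (F : Type*) [Field F] (p : ℕ) (t : Fin n → ℕ) :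
    Submodule F (Module.End F (O F n)) where
  carrier := {Φ | (∀ a ∈ oddOT F p t, Φ a ∈ oddOT F p t) ∧
    ∀ a ∈ oddOT F p t, ∀ b ∈ oddOT F p t, Φ (TH a b) = TH (Φ a) b + TH a (Φ b)}
  add_mem' := by
    rintro Φ Ψ ⟨hΦ, hΦ'⟩ ⟨hΨ, hΨ'⟩
    refine ⟨fun a ha => add_mem (hΦ a ha) (hΨ a ha), fun a ha b hb => ?_⟩
    simp only [LinearMap.add_apply, hΦ' a ha b hb, hΨ' a ha b hb, map_add]
    abel
  zero_mem' := ⟨fun _ _ => zero_mem _, by simp⟩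
  smul_mem' := by
    rintro c Φ ⟨hΦ, hΦ'⟩
    refine ⟨fun a ha => Submodule.smul_mem _ c (hΦ a ha), fun a ha b hb => ?_⟩
    simp only [LinearMap.smul_apply, hΦ' a ha b hb, map_smul, smul_add]

namespace oddDer

variable {Φ : Module.End F (O F n)}

lemma map_mem (hΦ : Φ ∈ oddDer F p t) {a : O F n} (ha : a ∈ oddOT F p t) : Φ a ∈ oddOT F p t :=
  hΦ.1 a ha

lemma map_TH (hΦ : Φ ∈ oddDer F p t) {a b : O F n} (ha : a ∈ oddOT F p t) (hb : b ∈ oddOT F p t) :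
    Φ (TH a b) = TH (Φ a) b + TH a (Φ b) :=
  hΦ.2 a ha b hb

lemma sub_mem {Ψ : Module.End F (O F n)} (hΦ : Φ ∈ oddDer F p t) (hΨ : Ψ ∈ oddDer F p t) :
    Φ - Ψ ∈ oddDer F p t :=
  sub_eq_add_neg Φ Ψ ▸ neg_one_smul F Ψ ▸ add_mem hΦ (Submodule.smul_mem _ (-1 : F) hΨ)

end oddDer

lemma TH_mem_oddDer [Fact p.Prime] [CharP F p] {z : O F n} (hz : z ∈ oddOT F p t) :
    TH z ∈ oddDer F p t :=
  ⟨fun _ ha => TH_mem_oddOT hz ha, fun _ ha b _ => TH_jacobi hz.2 ha.2 b⟩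

lemma ad_pow_char_pow {K A : Type*} [Field K] [Ring A] [Nontrivial A] [Algebra K A]
    [hp : Fact p.Prime] [CharP K p] (x : A) (k : ℕ) :
    LieAlgebra.ad K A x ^ p ^ k = LieAlgebra.ad K A (x ^ p ^ k) := by
  have : CharP (Module.End K A) p := charP_of_injective_algebraMap (algebraMap K _).injective p
  rw [LieAlgebra.ad_eq_lmul_left_sub_lmul_right, Pi.sub_apply, Pi.sub_apply,
    sub_pow_char_pow_of_commute _ _ (LinearMap.commute_mulLeft_right x x),
    LinearMap.pow_mulLeft, LinearMap.pow_mulRight]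

lemma lie_del_TH {a : O F n} (ha : a ∈ parityPart F n 1) (i : Fin n) :
    ⁅del (F := F) (.inl i), TH a⁆ = TH (del (.inl i) a) :=
  lie_eq_iff_forall_apply.2 fun b => by rw [del_TH_inl ha, add_comm]

lemma ad_del_pow_TH {a : O F n} (ha : a ∈ parityPart F n 1) (i : Fin n) (m : ℕ) :
    (LieAlgebra.ad F (Module.End F (O F n)) (del (.inl i)) ^ m) (TH a) =
      TH ((del (.inl i) ^ m) a) := by
  induction m with
  | zero => rfl
  | succ m ih =>
    rw [pow_succ', Module.End.mul_apply, ih, LieAlgebra.ad_apply,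
      lie_del_TH (del_inl_pow_mem_parityPart i m ha), pow_succ', Module.End.mul_apply]

lemma lie_del_pow_TH [Fact p.Prime] [CharP F p] {a : O F n} (ha : a ∈ parityPart F n 1)
    (i : Fin n) (k : ℕ) :
    ⁅del (F := F) (.inl i) ^ p ^ k, TH a⁆ = TH ((del (.inl i) ^ p ^ k) a) := by
  rw [← ad_del_pow_TH ha, ad_pow_char_pow, LieAlgebra.ad_apply]

lemma del_pow_mem_oddDer [Fact p.Prime] [CharP F p] (i : Fin n) (k : ℕ) :
    del (.inl i) ^ p ^ k ∈ oddDer F p t :=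
  ⟨fun _ ha => del_inl_pow_mem_oddOT i _ ha, fun _ ha b _ =>
    lie_eq_iff_forall_apply.1 (lie_del_pow_TH ha.2 i k) b⟩

/-! ### The degree derivation `Γ` -/

lemma Gam_mono (α : Fin n → ℕ) (u : Finset (Fin n)) :
    Gam F n (mono α u) = (u.card : F) • mono α u := by
  simp only [Gam, LinearMap.sum_apply, Module.End.mul_apply, mul_mono_del_inr_mono, binom_zero_left,
    zero_add, Nat.cast_one, one_smul]
  rw [Finset.sum_ite_mem, Finset.univ_inter, Finset.sum_const, Nat.cast_smul_eq_nsmul]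

lemma Gam_mul (f g : O F n) : Gam F n (mul f g) = mul (Gam F n f) g + mul f (Gam F n g) := by
  have key : (mul : O F n →ₗ[F] O F n →ₗ[F] O F n).compr₂ (Gam F n) =
      mul ∘ₗ Gam F n + mul.compl₂ (Gam F n) := by
    refine ext_mono fun α u => ext_mono fun β v => ?_
    simp only [LinearMap.compr₂_apply, LinearMap.add_apply, LinearMap.comp_apply,
      LinearMap.compl₂_apply, Gam_mono, map_smul, LinearMap.smul_apply, mul_mono]
    split_ifs with h
    · rw [map_smul, Gam_mono, ← add_smul, smul_comm, Finset.card_union_of_disjoint h, Nat.cast_add]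
    · simp
  exact LinearMap.congr_fun₂ key f g

lemma Gam_del_inl (i : Fin n) (f : O F n) :
    Gam F n (del (.inl i) f) = del (.inl i) (Gam F n f) := by
  have key : Gam F n ∘ₗ del (.inl i) = del (.inl i) ∘ₗ Gam F n := by
    refine ext_mono fun α u => ?_
    simp only [LinearMap.comp_apply, Gam_mono, map_smul, del_inl_mono]
    split_ifs <;> simp [Gam_mono]
  exact LinearMap.congr_fun key f

lemma Gam_del_inr (i : Fin n) (f : O F n) :
    Gam F n (del (.inr i) f) = del (.inr i) (Gam F n f) - del (.inr i) f := by
  have key : Gam F n ∘ₗ del (.inr i) = del (.inr i) ∘ₗ Gam F n - del (.inr i) := by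
    refine ext_mono fun α u => ?_
    simp only [LinearMap.comp_apply, LinearMap.sub_apply, Gam_mono, map_smul, del_inr_mono]
    split_ifs with h
    · rw [map_smul, Gam_mono, ← Finset.card_erase_add_one h, smul_comm]
      push_cast
      rw [add_smul, one_smul, add_sub_cancel_right]
    · simp
  exact LinearMap.congr_fun key f

lemma Gam_mem_parityPart {j : ZMod 2} {a : O F n} (ha : a ∈ parityPart F n j) :
    Gam F n a ∈ parityPart F n j := by
  have : parityPart F n j ≤ (parityPart F n j).comap (Gam F n) := by
    refine parityPart_induction fun α u hu => ?_
    rw [Submodule.mem_comap, Gam_mono]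
    exact Submodule.smul_mem _ _ (mem_parityPart_mono hu)
  exact this ha

lemma Gam_mem_oddOT {a : O F n} (ha : a ∈ oddOT F p t) : Gam F n a ∈ oddOT F p t := by
  have : oddOT F p t ≤ (oddOT F p t).comap (Gam F n) := by
    refine oddOT_le fun α hα u hu => ?_
    rw [Submodule.mem_comap, Gam_mono]
    exact Submodule.smul_mem _ _ (mono_mem_oddOT hα hu)
  exact this ha

lemma lie_Gam_TH {a : O F n} (ha : a ∈ parityPart F n 1) :
    ⁅Gam F n, TH a⁆ = TH ((Gam F n - 1) a) := by
  refine lie_eq_iff_forall_apply.2 fun b => ?_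
  rw [LinearMap.sub_apply, Module.End.one_apply, TH_odd ha, TH_odd ha,
    TH_odd (sub_mem (Gam_mem_parityPart ha) ha), map_sum, ← Finset.sum_add_distrib]
  refine Finset.sum_congr rfl fun i _ => ?_
  simp only [map_sub, Gam_mul, Gam_del_inl, Gam_del_inr, LinearMap.sub_apply]
  abel

lemma Gam_sub_one_mem_oddDer : Gam F n - 1 ∈ oddDer F p t := by
  refine ⟨fun a ha => sub_mem (Gam_mem_oddOT ha) ha, fun a ha b _ => ?_⟩
  rw [LinearMap.sub_apply, lie_eq_iff_forall_apply.1 (lie_Gam_TH ha.2) b]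
  simp only [LinearMap.sub_apply, Module.End.one_apply, map_sub]
  abel

/-! ### Reduction modulo inner derivations -/

/-- The element of the odd part of `𝒪(n,n;t)` with coefficients `g`; the values of `g` outside the
index set of its basis are ignored. -/
noncomputable def ofCoeff (p : ℕ) (t : Fin n → ℕ) (g : (Fin n → ℕ) → Finset (Fin n) → F) : O F n :=
  Finsupp.indicator
    (Fintype.piFinset (fun i => Finset.range (p ^ t i)) ×ˢ
      Finset.univ.filter fun u : Finset (Fin n) => Odd u.card)
    fun x _ => g x.1 x.2

lemma ofCoeff_apply (g : (Fin n → ℕ) → Finset (Fin n) → F) (γ : Fin n → ℕ) (w : Finset (Fin n))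
    [Decidable (γ ∈ box p t ∧ Odd w.card)] :
    ofCoeff p t g (γ, w) = if γ ∈ box p t ∧ Odd w.card then g γ w else 0 := by
  rw [ofCoeff, Finsupp.indicator_apply]
  exact if_congr (by simp [box]) rfl rfl

lemma ofCoeff_mem_oddOT (g : (Fin n → ℕ) → Finset (Fin n) → F) : ofCoeff p t g ∈ oddOT F p t := by
  classical
  refine mem_oddOT_of_forall fun γ w h => ?_
  rw [ofCoeff_apply] at h
  exact (ite_ne_right_iff.1 h).1

lemma exists_forall_add_single_eq {ι M : Type*} [DecidableEq ι] [Nonempty M]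
    {y : ι → (ι → ℕ) → M}
    (hy : ∀ i j (γ : ι → ℕ), y j (γ + Pi.single i 1) = y i (γ + Pi.single j 1)) :
    ∃ g : (ι → ℕ) → M, ∀ i γ, g (γ + Pi.single i 1) = y i γ := by
  classical
  refine ⟨fun γ => if h : ∃ i, γ i ≠ 0 then y h.choose (γ - Pi.single h.choose 1)
    else Classical.arbitrary M, fun i γ => ?_⟩
  have h : ∃ j, (γ + Pi.single i 1 : ι → ℕ) j ≠ 0 := ⟨i, by simp⟩
  refine (dif_pos h).trans ?_
  generalize hj : h.choose = j
  have hj' : (γ + Pi.single i 1 : ι → ℕ) j ≠ 0 := hj ▸ h.choose_spec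
  obtain rfl | hij := eq_or_ne j i
  · rw [add_tsub_cancel_right]
  · obtain ⟨γ, rfl⟩ : ∃ δ, γ = δ + Pi.single j 1 := by
      refine ⟨γ - Pi.single j 1, (tsub_add_cancel_of_le fun k => ?_).symm⟩
      obtain rfl | hk := eq_or_ne k j
      · simpa [hij, Nat.one_le_iff_ne_zero] using hj'
      · simp [hk]
    rw [add_right_comm, add_tsub_cancel_right, hy]

/-- The Poincaré lemma for truncated divided powers: besides being closed, the `y i` must have no
coefficients at the highest power of `x_i`. -/
lemma exists_del_inl_eq {y : Fin n → O F n} (hy : ∀ i, y i ∈ oddOT F p t)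
    (hclosed : ∀ i j, del (.inl i) (y j) = del (.inl j) (y i))
    (htop : ∀ i γ w, γ i + 1 = p ^ t i → y i (γ, w) = 0) :
    ∃ z ∈ oddOT F p t, ∀ i, del (.inl i) z = y i := by
  classical
  obtain ⟨g, hg⟩ := exists_forall_add_single_eq (y := fun i γ w => y i (γ, w)) fun i j γ => by
    funext w
    rw [← del_inl_apply, hclosed, del_inl_apply]
  refine ⟨ofCoeff p t g, ofCoeff_mem_oddOT g, fun i => ?_⟩
  ext ⟨γ, w⟩
  rw [del_inl_apply, ofCoeff_apply, hg]
  refine ite_eq_left_iff.2 fun h => ?_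
  by_contra hne
  refine h ⟨fun k => ?_, odd_card_of_apply_ne_zero (hy i).2 (Ne.symm hne)⟩
  have hk : γ k < p ^ t k := mem_box_of_apply_ne_zero (hy i) (Ne.symm hne) k
  obtain rfl | hki := eq_or_ne k i
  · have := mt (htop k γ w) (Ne.symm hne)
    simp only [Pi.add_apply, Pi.single_eq_same]
    lia
  · simpa [hki] using hk

/-- The first cohomology of the torus with values in the elements free of even variables
vanishes. -/
lemma exists_TH_torus_eq [Fact p.Prime] {c : Fin n → O F n} (hc : ∀ i, c i ∈ parityPart F n 1)
    (hdel : ∀ i k, del (.inl k) (c i) = 0)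
    (hcomm : ∀ i j, TH (torus F i) (c j) = TH (torus F j) (c i)) :
    ∃ z ∈ oddOT F p t, (∀ k, del (.inl k) z = 0) ∧ ∀ i, TH (torus F i) z = c i := by
  classical
  have hcoeff : ∀ w : Finset (Fin n), ∃ a : F, Odd w.card →
      ∀ i, (if i ∈ w then 1 else 0) * a = c i (0, w) := by
    intro w
    obtain rfl | ⟨j, hj⟩ := w.eq_empty_or_nonempty
    · exact ⟨0, by simp⟩
    · refine ⟨c j (0, w), fun _ i => ?_⟩
      have := DFunLike.congr_fun (hcomm i j) (0, w)
      rw [TH_torus_apply, TH_torus_apply] at this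
      simpa [weight, hj] using this
  choose a ha using hcoeff
  have hz : ∀ k, del (.inl k) (ofCoeff p t fun γ w => if γ = 0 then a w else 0) = 0 := by
    intro k
    ext ⟨γ, w⟩
    simp [del_inl_apply, ofCoeff_apply]
  refine ⟨_, ofCoeff_mem_oddOT _, hz, fun i => ?_⟩
  ext ⟨γ, w⟩
  obtain rfl | hγ := eq_or_ne γ 0
  · rw [TH_torus_apply, ofCoeff_apply]
    by_cases hw : Odd w.card
    · simpa [weight, zero_mem_box, hw] using ha w hw i
    · simpa [hw] using (not_imp_comm.1 (odd_card_of_apply_ne_zero (hc i)) hw).symm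
  · rw [TH_torus_apply, apply_eq_zero_of_del_inl hz hγ, apply_eq_zero_of_del_inl (hdel i) hγ,
      mul_zero]

lemma update_zero_add_single {ι : Type*} [DecidableEq ι] (γ : ι → ℕ) (i : ι) :
    Function.update γ i 0 + Pi.single i (γ i) = γ := by
  funext j
  obtain rfl | hj := eq_or_ne j i
  · simp
  · simp [hj]

lemma ad_apply_apply {R M : Type*} [CommRing R] [AddCommGroup M] [Module R M]
    (D E : Module.End R M) (x : M) :
    LieAlgebra.ad R (Module.End R M) D E x = D (E x) - E (D x) := rfl

namespace oddDer

variable [Fact p.Prime] {Φ : Module.End F (O F n)} (hΦ : Φ ∈ oddDer F p t)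
include hΦ

lemma map_del (i : Fin n) {b : O F n} (hb : b ∈ oddOT F p t) :
    del (.inl i) (Φ b) - Φ (del (.inl i) b) = TH (Φ (mono 0 {i})) b := by
  have := map_TH hΦ (mono_singleton_mem_oddOT zero_mem_box i) hb
  rw [TH_mono_zero, TH_mono_zero, map_neg] at this
  rw [neg_eq_iff_eq_neg.1 this]
  abel

lemma ad_del_pow_apply (i : Fin n) (m : ℕ) {b : O F n} (hb : b ∈ oddOT F p t) :
    (LieAlgebra.ad F (Module.End F (O F n)) (del (.inl i)) ^ (m + 1)) Φ b =
      TH ((del (.inl i) ^ m) (Φ (mono 0 {i}))) b := by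
  have hy : Φ (mono 0 {i}) ∈ oddOT F p t := map_mem hΦ (mono_singleton_mem_oddOT zero_mem_box i)
  induction m generalizing b with
  | zero =>
    simpa only [zero_add, pow_one, pow_zero, Module.End.one_apply, ad_apply_apply]
      using map_del hΦ i hb
  | succ m ih =>
    rw [pow_succ', Module.End.mul_apply, ad_apply_apply, ih hb,
      ih (del_inl_mem_oddOT i hb), pow_succ' (del (.inl i)), Module.End.mul_apply,
      del_TH_inl (del_inl_pow_mem_parityPart i m hy.2), add_sub_cancel_left]

/-- The terms with `x_i^(p^{t_i}-1)` are the obstruction to integrating `Φ(x_{i'})` in `𝒪(n,n;t)`.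
They are absent because `(ad ∂_i)^{p^{t_i}} = ad (∂_i^{p^{t_i}})` kills `Φ`. -/
lemma apply_mono_zero_eq_zero [CharP F p] (ht : ∀ i, 1 ≤ t i) {i : Fin n} {γ : Fin n → ℕ}
    (hγ : γ i + 1 = p ^ t i) (w : Finset (Fin n)) : Φ (mono 0 {i}) (γ, w) = 0 := by
  have hy : Φ (mono 0 {i}) ∈ oddOT F p t := map_mem hΦ (mono_singleton_mem_oddOT zero_mem_box i)
  have hdel : ∀ a ∈ oddOT F p t, (del (.inl i) ^ p ^ t i) a = 0 := fun a ha => by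
    ext ⟨δ, v⟩
    rw [del_inl_pow_apply]
    by_contra h
    simpa using mem_box_of_apply_ne_zero ha h i
  have hz : (del (.inl i) ^ γ i) (Φ (mono 0 {i})) = 0 := by
    have hodd := del_inl_pow_mem_parityPart i (γ i) hy.2
    refine eq_zero_of_forall_TH_eq_zero (p := p) ht hodd fun b hb => ?_
    rw [← ad_del_pow_apply hΦ i _ hb, hγ, ad_pow_char_pow, ad_apply_apply,
      hdel _ (map_mem hΦ hb), hdel _ hb, map_zero, sub_zero]
  rw [← update_zero_add_single γ i, ← del_inl_pow_apply, hz, Finsupp.zero_apply]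

lemma exists_kills_mono_zero [CharP F p] (ht : ∀ i, 1 ≤ t i) :
    ∃ z ∈ oddOT F p t, ∀ i, (Φ - TH z) (mono 0 {i}) = 0 := by
  have hy (i) : Φ (mono 0 {i}) ∈ oddOT F p t :=
    map_mem hΦ (mono_singleton_mem_oddOT zero_mem_box i)
  have hclosed (i j) : del (.inl i) (Φ (mono 0 {j})) = del (.inl j) (Φ (mono 0 {i})) := by
    simpa [del_inl_mono, TH_apply_mono_zero (hy i).2] using
      map_del hΦ i (mono_singleton_mem_oddOT zero_mem_box j)
  obtain ⟨z, hz, hdel⟩ := exists_del_inl_eq hy hclosed fun i γ w hγ =>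
    apply_mono_zero_eq_zero hΦ ht hγ w
  exact ⟨z, hz, fun i => by
    rw [LinearMap.sub_apply, TH_apply_mono_zero hz.2, hdel, sub_self]⟩

end oddDer

/-- The derivations left after subtracting a suitable inner derivation: those that commute with the
`∂_i` and with the torus. -/
structure IsReduced (p : ℕ) (t : Fin n → ℕ) (Φ : Module.End F (O F n)) : Prop where
  mem_oddDer : Φ ∈ oddDer F p t
  map_mono_zero : ∀ i, Φ (mono 0 {i}) = 0
  map_torus : ∀ i, Φ (torus F i) = 0

lemma del_inl_torus (i k : Fin n) :
    del (.inl k) (torus F i) = if k = i then mono 0 {i} else 0 := by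
  obtain rfl | hki := eq_or_ne k i
  · simp [torus, del_inl_mono]
  · simp [torus, del_inl_mono, hki]

lemma TH_torus_torus (i j : Fin n) : TH (torus F i) (torus F j) = 0 := by
  rw [torus.eq_def F j, TH_torus_mono]
  obtain rfl | hij := eq_or_ne i j
  · simp [weight]
  · simp [weight, hij]

lemma oddDer.map_del_of_kills_mono_zero [Fact p.Prime] {Φ : Module.End F (O F n)}
    (hΦ : Φ ∈ oddDer F p t) (h₀ : ∀ i, Φ (mono 0 {i}) = 0) (i : Fin n) {b : O F n}
    (hb : b ∈ oddOT F p t) : del (.inl i) (Φ b) = Φ (del (.inl i) b) := by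
  have := map_del hΦ i hb
  rwa [h₀, map_zero, LinearMap.zero_apply, sub_eq_zero] at this

lemma oddDer.exists_isReduced [Fact p.Prime] [CharP F p] (ht : ∀ i, 1 ≤ t i)
    {Φ : Module.End F (O F n)} (hΦ : Φ ∈ oddDer F p t) :
    ∃ z ∈ oddOT F p t, IsReduced p t (Φ - TH z) := by
  obtain ⟨z, hz, h₀⟩ := exists_kills_mono_zero hΦ ht
  have hΨ : Φ - TH z ∈ oddDer F p t := sub_mem hΦ (TH_mem_oddDer hz)
  have hc (i) : (Φ - TH z) (torus F i) ∈ parityPart F n 1 := (map_mem hΨ (torus_mem_oddOT ht i)).2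
  have hdel (i k) : del (.inl k) ((Φ - TH z) (torus F i)) = 0 := by
    rw [map_del_of_kills_mono_zero hΨ h₀ k (torus_mem_oddOT ht i), del_inl_torus]
    split_ifs
    · exact h₀ i
    · exact map_zero _
  have hcomm (i j) : TH (torus F i) ((Φ - TH z) (torus F j)) =
      TH (torus F j) ((Φ - TH z) (torus F i)) := by
    have := map_TH hΨ (torus_mem_oddOT ht i) (torus_mem_oddOT ht j)
    rw [TH_torus_torus, map_zero, TH_apply_torus (hc i)] at this
    exact (neg_add_eq_zero.1 this.symm).symm
  obtain ⟨z', hz', hdel', htorus⟩ := exists_TH_torus_eq (p := p) (t := t) hc hdel hcomm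
  have hsub : Φ - TH (z - z') = Φ - TH z + TH z' := by
    rw [map_sub]
    abel
  have hmem : z - z' ∈ oddOT F p t := Submodule.sub_mem _ hz hz'
  refine ⟨z - z', hmem, sub_mem hΦ (TH_mem_oddDer hmem), fun i => ?_, fun i => ?_⟩
  · rw [hsub, LinearMap.add_apply, h₀, TH_apply_mono_zero hz'.2, hdel', add_zero]
  · rw [hsub, LinearMap.add_apply, TH_apply_torus hz'.2, htorus, add_neg_cancel]

namespace IsReduced

variable [Fact p.Prime] {Φ : Module.End F (O F n)} (hΦ : IsReduced p t Φ)
include hΦ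

lemma map_del (i : Fin n) {b : O F n} (hb : b ∈ oddOT F p t) :
    del (.inl i) (Φ b) = Φ (del (.inl i) b) :=
  oddDer.map_del_of_kills_mono_zero hΦ.mem_oddDer hΦ.map_mono_zero i hb

lemma map_TH_torus (ht : ∀ i, 1 ≤ t i) (i : Fin n) {b : O F n} (hb : b ∈ oddOT F p t) :
    Φ (TH (torus F i) b) = TH (torus F i) (Φ b) := by
  rw [oddDer.map_TH hΦ.mem_oddDer (torus_mem_oddOT ht i) hb, hΦ.map_torus, map_zero,
    LinearMap.zero_apply, zero_add]

lemma weight_eq (ht : ∀ i, 1 ≤ t i) {α γ : Fin n → ℕ} {u w : Finset (Fin n)} (hα : α ∈ box p t)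
    (hu : Odd u.card) (hne : Φ (mono α u) (γ, w) ≠ 0) : weight F γ w = weight F α u := by
  funext i
  have := DFunLike.congr_fun (hΦ.map_TH_torus ht i (mono_mem_oddOT hα hu)) (γ, w)
  rw [TH_torus_mono, map_smul, Finsupp.smul_apply, smul_eq_mul, TH_torus_apply] at this
  exact (mul_right_cancel₀ hne this).symm

lemma eq_zero_and_weight_eq (ht : ∀ i, 1 ≤ t i) {α γ : Fin n → ℕ} {u w : Finset (Fin n)}
    (hα : α ∈ box p t) (hu : Odd u.card) (hdel : ∀ i, Φ (del (.inl i) (mono α u)) = 0)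
    (hne : Φ (mono α u) (γ, w) ≠ 0) : γ = 0 ∧ weight F 0 w = weight F α u := by
  obtain rfl : γ = 0 := by
    by_contra hγ
    refine hne (apply_eq_zero_of_del_inl (fun i => ?_) hγ w)
    rw [hΦ.map_del i (mono_mem_oddOT hα hu), hdel]
  exact ⟨rfl, hΦ.weight_eq ht hα hu hne⟩

end IsReduced

/-! ### Elements that are linear in the odd variables -/

/-- The combination `∑ d_{i,k} ∂_i^{p^k}`, `1 ≤ k < t_i`, as a linear function of the
coefficients `d`. -/
noncomputable def delPowers (F : Type*) [Field F] (p : ℕ) (t : Fin n → ℕ) :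
    (Fin n → ℕ → F) →ₗ[F] Module.End F (O F n) :=
  ∑ i, ∑ k ∈ Finset.Ico 1 (t i),
    (LinearMap.proj (R := F) (φ := fun _ : ℕ => F) k ∘ₗ LinearMap.proj i).smulRight
      (del (.inl i) ^ p ^ k)

lemma delPowers_eq_sum (d : Fin n → ℕ → F) :
    delPowers F p t d = ∑ i, ∑ k ∈ Finset.Ico 1 (t i), d i k • del (.inl i) ^ p ^ k := by
  simp [delPowers]

lemma delPowers_apply_apply (d : Fin n → ℕ → F) (f : O F n) (γ : Fin n → ℕ) (w : Finset (Fin n)) :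
    delPowers F p t d f (γ, w) =
      ∑ i, ∑ k ∈ Finset.Ico 1 (t i), d i k * f (γ + Pi.single i (p ^ k), w) := by
  simp [delPowers_eq_sum, Finsupp.finsetSum_apply, del_inl_pow_apply]

lemma delPowers_mem_oddDer [Fact p.Prime] [CharP F p] (d : Fin n → ℕ → F) :
    delPowers F p t d ∈ oddDer F p t := by
  rw [delPowers_eq_sum]
  exact sum_mem fun i _ => sum_mem fun k _ => Submodule.smul_mem _ _ (del_pow_mem_oddDer i k)

lemma delPowers_mono_eq_zero [hp : Fact p.Prime] (d : Fin n → ℕ → F) {α : Fin n → ℕ}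
    (h : ∀ i, α i ≤ 1) (u : Finset (Fin n)) : delPowers F p t d (mono α u) = 0 := by
  ext ⟨γ, w⟩
  rw [delPowers_apply_apply]
  refine Finset.sum_eq_zero fun i _ => Finset.sum_eq_zero fun k hk => ?_
  rw [mono_apply, if_neg, mul_zero]
  rintro ⟨rfl, -⟩
  have hlt := Nat.one_lt_pow (Nat.one_le_iff_ne_zero.1 (Finset.mem_Ico.1 hk).1) hp.out.one_lt
  have hle : γ i + p ^ k ≤ 1 := by simpa using h i
  lia

lemma delPowers_torus [Fact p.Prime] (d : Fin n → ℕ → F) (i : Fin n) :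
    delPowers F p t d (torus F i) = 0 :=
  delPowers_mono_eq_zero d (fun k => by by_cases hk : k = i <;> simp [hk]) _

lemma delPowers_mono_single [hp : Fact p.Prime] (d : Fin n → ℕ → F) {i : Fin n} {s : ℕ}
    (hs : s ∈ Finset.Ico 1 (t i)) (u : Finset (Fin n)) :
    delPowers F p t d (mono (Pi.single i (p ^ s)) u) (0, u) = d i s := by
  have hcond (j : Fin n) (k : ℕ) :
      (Pi.single i (p ^ s) : Fin n → ℕ) = Pi.single j (p ^ k) ↔ i = j ∧ s = k := by
    refine ⟨fun h => ?_, by rintro ⟨rfl, rfl⟩; rfl⟩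
    have hi := congrFun h i
    obtain rfl | hij := eq_or_ne i j
    · exact ⟨rfl, Nat.pow_right_injective hp.out.two_le (by simpa using hi)⟩
    · simp [hij, hp.out.ne_zero] at hi
  simp only [delPowers_apply_apply, zero_add, mono_apply, hcond, and_true]
  rw [Finset.sum_eq_single_of_mem i (Finset.mem_univ i), Finset.sum_eq_single_of_mem s hs]
  · simp
  · intro k _ hk
    simp [hk.symm]
  · intro j _ hj
    simp [hj.symm]

lemma choose_mul_mul_modEq (hp : p.Prime) (m k : ℕ) :
    (p * m).choose (p * k) ≡ m.choose k [MOD p] := by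
  have : Fact p.Prime := ⟨hp⟩
  simpa [Nat.mul_div_cancel_left, hp.pos] using
    Choose.choose_modEq_choose_mod_mul_choose_div_nat (n := p * m) (k := p * k) (p := p)

lemma choose_pow_mul_pow_modEq (hp : p.Prime) (k m : ℕ) :
    (p ^ k * m).choose (p ^ k) ≡ m [MOD p] := by
  induction k with
  | zero => simp [Nat.ModEq.refl]
  | succ k ih => simpa only [pow_succ', mul_assoc] using (choose_mul_mul_modEq hp _ _).trans ih

/-- In the Witt algebra, `x^(a)∂` is a bracket of elements other than `x^(a)∂` and `∂`, up to a
nonzero scalar. -/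
lemma exists_choose_ne_choose_succ [hp : Fact p.Prime] [CharP F p] {a : ℕ} (ha : a ≠ 0)
    (hpa : p ∣ a) (hpow : ∀ s, a ≠ p ^ s) :
    ∃ b, 0 < b ∧ b + 1 < a ∧ (a.choose b : F) ≠ (a.choose (b + 1) : F) := by
  obtain ⟨k, m, hm, rfl⟩ := Nat.exists_eq_pow_mul_and_not_dvd ha p hp.out.ne_one
  have hk : k ≠ 0 := by
    rintro rfl
    exact hm (by simpa using hpa)
  have hk1 : 1 < p ^ k := Nat.one_lt_pow hk hp.out.one_lt
  have hm1 : 1 < m := by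
    have := hpow k
    have : m ≠ 0 := by rintro rfl; simp at hm
    have : m ≠ 1 := by rintro rfl; simp at *
    lia
  have hlt : p ^ k < p ^ k * m := lt_mul_of_one_lt_right (by lia) hm1
  obtain ⟨b, hb⟩ : ∃ b, p ^ k = b + 1 := ⟨p ^ k - 1, by lia⟩
  refine ⟨b, by lia, by lia, ?_⟩
  have hpk : ((p ^ k : ℕ) : F) = 0 := by simp [hk]
  have hzero : ((p ^ k * m).choose b : F) = 0 := by
    have := congrArg (Nat.cast (R := F)) (Nat.choose_succ_right_eq (p ^ k * m) b)
    rw [← hb, Nat.cast_mul, hpk, mul_zero, Nat.cast_mul, Nat.cast_sub (by lia), Nat.cast_mul,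
      hpk] at this
    have hb' : (b : F) = -1 := by
      rw [hb] at hpk
      push_cast at hpk
      exact eq_neg_of_add_eq_zero_left hpk
    rw [hb'] at this
    simpa using this.symm
  rw [hzero, ← hb, (CharP.natCast_eq_natCast F p).2 (choose_pow_mul_pow_modEq hp.out k m), ne_comm,
    Ne, CharP.cast_eq_zero_iff F p]
  exact hm

lemma oddDer.map_TH_eq_zero {Φ : Module.End F (O F n)} (hΦ : Φ ∈ oddDer F p t) {a b : O F n}
    (ha : a ∈ oddOT F p t) (hb : b ∈ oddOT F p t) (ha₀ : Φ a = 0) (hb₀ : Φ b = 0) :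
    Φ (TH a b) = 0 := by
  rw [map_TH hΦ ha hb, ha₀, hb₀, map_zero, map_zero, LinearMap.zero_apply, zero_add]

/-- The derivations of `oddOT` that kill all elements that are linear in the odd variables. -/
structure KillsLinear (p : ℕ) (t : Fin n → ℕ) (Φ : Module.End F (O F n)) : Prop where
  mem_oddDer : Φ ∈ oddDer F p t
  map_mono_singleton : ∀ {α}, α ∈ box p t → ∀ j, Φ (mono α {j}) = 0

namespace IsReduced

variable [hp : Fact p.Prime] {Φ : Module.End F (O F n)} (hΦ : IsReduced p t Φ)
include hΦ

lemma sub_delPowers [CharP F p] (d : Fin n → ℕ → F) : IsReduced p t (Φ - delPowers F p t d) where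
  mem_oddDer := oddDer.sub_mem hΦ.mem_oddDer (delPowers_mem_oddDer d)
  map_mono_zero i := by
    rw [LinearMap.sub_apply, hΦ.map_mono_zero, delPowers_mono_eq_zero d (by simp), sub_zero]
  map_torus i := by rw [LinearMap.sub_apply, hΦ.map_torus, delPowers_torus, sub_zero]

lemma eq_of_apply_mono_single_ne_zero [CharP F p] (ht : ∀ i, 1 ≤ t i) {i : Fin n} {a : ℕ}
    (ha : a < p ^ t i) (hdel : ∀ k, Φ (del (.inl k) (mono (Pi.single i a) {i})) = 0)
    {γ : Fin n → ℕ} {w : Finset (Fin n)} (hne : Φ (mono (Pi.single i a) {i}) (γ, w) ≠ 0) :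
    γ = 0 ∧ w = {i} ∧ p ∣ a := by
  obtain ⟨rfl, hw⟩ := hΦ.eq_zero_and_weight_eq ht (single_mem_box ha) (by simp) hdel hne
  have hwi : w ⊆ {i} := fun j hj => by
    by_contra hji
    rw [Finset.mem_singleton] at hji
    simpa [weight, hj, hji] using congrFun hw j
  have hodd : Odd w.card := odd_card_of_apply_ne_zero (oddDer.map_mem hΦ.mem_oddDer
    (mono_singleton_mem_oddOT (single_mem_box ha) i)).2 hne
  obtain rfl := (Finset.Nonempty.subset_singleton_iff (Finset.card_pos.1 hodd.pos)).1 hwi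
  refine ⟨rfl, rfl, ?_⟩
  rw [← CharP.cast_eq_zero_iff F p]
  simpa [weight, eq_comm (a := (1 : F))] using congrFun hw i

lemma map_mono_single_self [CharP F p] (ht : ∀ i, 1 ≤ t i)
    (hpow : ∀ i, ∀ s ∈ Finset.Ico 1 (t i), Φ (mono (Pi.single i (p ^ s)) {i}) (0, {i}) = 0)
    (i : Fin n) {a : ℕ} (ha : a < p ^ t i) : Φ (mono (Pi.single i a) {i}) = 0 := by
  induction a using Nat.strong_induction_on with
  | _ a ih =>
  obtain rfl | ha₀ := eq_or_ne a 0
  · simpa using hΦ.map_mono_zero i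
  have hmem {b : ℕ} (hb : b < p ^ t i) : (mono (Pi.single i b) {i} : O F n) ∈ oddOT F p t :=
    mono_singleton_mem_oddOT (single_mem_box hb) i
  have hdel (k) : Φ (del (.inl k) (mono (Pi.single i a) {i})) = 0 := by
    obtain ⟨b, rfl⟩ := Nat.exists_eq_add_one_of_ne_zero ha₀
    obtain rfl | hk := eq_or_ne k i
    · rw [Pi.single_add, del_inl_mono_add]
      exact ih b (by lia) (by lia)
    · simp [del_inl_mono, hk]
  by_contra h
  obtain ⟨⟨γ, w⟩, hne⟩ := Finsupp.ne_iff.1 h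
  obtain ⟨rfl, rfl, hpa⟩ := hΦ.eq_of_apply_mono_single_ne_zero ht ha hdel hne
  by_cases hs : ∃ s, a = p ^ s
  · obtain ⟨s, rfl⟩ := hs
    refine hne (hpow i s (Finset.mem_Ico.2 ⟨?_, (Nat.pow_lt_pow_iff_right hp.out.one_lt).1 ha⟩))
    rw [Nat.one_le_iff_ne_zero]
    rintro rfl
    exact hp.out.one_lt.ne' (Nat.dvd_one.1 (by simpa using hpa))
  · obtain ⟨b, hb, hba, hchoose⟩ := exists_choose_ne_choose_succ (F := F) ha₀ hpa (not_exists.1 hs)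
    have := oddDer.map_TH_eq_zero hΦ.mem_oddDer (hmem (b := b + 1) (by lia))
      (hmem (b := a - b) (by lia)) (ih (b + 1) hba (by lia)) (ih (a - b) (by lia) (by lia))
    rw [TH_mono_single_mono, ← Pi.single_add, if_pos (Finset.mem_singleton_self i),
      Pi.single_eq_same, Nat.add_sub_cancel' (by lia), Nat.sub_add_cancel (by lia), map_smul]
      at this
    exact h ((smul_eq_zero.1 this).resolve_left (sub_ne_zero.2 hchoose))

lemma map_mono_singleton_eq_zero_of_apply_eq_one (h2 : (2 : F) ≠ 0) (ht : ∀ i, 1 ≤ t i)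
    {α : Fin n → ℕ} (hα : α ∈ box p t) {i j : Fin n} (hij : i ≠ j) (hi : α i = 1)
    (hdel : ∀ k, Φ (del (.inl k) (mono α {j})) = 0) : Φ (mono α {j}) = 0 := by
  by_contra h
  obtain ⟨⟨γ, w⟩, hne⟩ := Finsupp.ne_iff.1 h
  have hw := congrFun (hΦ.eq_zero_and_weight_eq ht hα (by simp) hdel hne).2 i
  by_cases hiw : i ∈ w
  · have h_one : (1 : F) = -1 := by simpa [weight, hiw, hij, hi] using hw
    exact h2 (by linear_combination h_one)
  · simp [weight, hiw, hij, hi] at hw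

lemma map_mono_singleton_eq_zero [CharP F p] (h2 : (2 : F) ≠ 0) (ht : ∀ i, 1 ≤ t i)
    (hpow : ∀ i, ∀ s ∈ Finset.Ico 1 (t i), Φ (mono (Pi.single i (p ^ s)) {i}) (0, {i}) = 0)
    {α : Fin n → ℕ} (hα : α ∈ box p t) (j : Fin n) : Φ (mono α {j}) = 0 := by
  induction α using WellFoundedLT.induction with
  | _ α ih =>
  by_cases h : ∃ i, i ≠ j ∧ α i ≠ 0
  · obtain ⟨i, hij, hi⟩ := h
    have hle : Function.update α i 1 ≤ α := update_le_self_iff.2 (by lia)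
    obtain heq | hlt := hle.eq_or_lt
    · have hi1 : α i = 1 := by simpa using (congrFun heq i).symm
      refine hΦ.map_mono_singleton_eq_zero_of_apply_eq_one h2 ht hα hij hi1 fun k => ?_
      rw [del_inl_mono]
      split_ifs with hk
      · exact map_zero _
      · refine ih _ (lt_of_le_of_ne tsub_le_self fun h => ?_) (mem_box_of_le tsub_le_self hα)
        simpa using (sub_single_add hk).symm.trans (congrArg (· + _) h)
    · obtain ⟨a, ha⟩ := Nat.exists_eq_add_one_of_ne_zero hi
      have hadd : Function.update α i 1 + Pi.single i a = α := by
        funext k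
        obtain rfl | hk := eq_or_ne k i
        · simp [ha, add_comm]
        · simp [hk]
      have hbox := mem_box_of_le hle hα
      have := oddDer.map_TH_eq_zero hΦ.mem_oddDer
        (mono_singleton_mem_oddOT (single_mem_box (hα i)) i) (mono_singleton_mem_oddOT hbox j)
        (hΦ.map_mono_single_self ht hpow i (hα i)) (ih _ hlt hbox)
      rw [ha, TH_mono_single_mono, hadd] at this
      simpa [hij] using this
  · push Not at h
    have hsingle : α = Pi.single j (α j) := by
      funext k
      obtain rfl | hk := eq_or_ne k j
      · simp
      · simp [hk, h k hk]
    rw [hsingle]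
    exact hΦ.map_mono_single_self ht hpow j (hα j)

lemma exists_killsLinear [CharP F p] (h2 : (2 : F) ≠ 0) (ht : ∀ i, 1 ≤ t i) :
    ∃ d, KillsLinear p t (Φ - delPowers F p t d) := by
  refine ⟨fun i s => Φ (mono (Pi.single i (p ^ s)) {i}) (0, {i}), ?_⟩
  have hΨ := hΦ.sub_delPowers fun i s => Φ (mono (Pi.single i (p ^ s)) {i}) (0, {i})
  refine ⟨hΨ.mem_oddDer, hΨ.map_mono_singleton_eq_zero h2 ht fun i s hs => ?_⟩
  rw [LinearMap.sub_apply, Finsupp.sub_apply, delPowers_mono_single _ hs, sub_self]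

end IsReduced

/-! ### Multiples of the degree derivation -/

lemma eq_of_card_eq_of_exchange {ι β : Type*} [DecidableEq ι] {f : Finset ι → β} {k : ℕ}
    (hf : ∀ u : Finset ι, u.card = k → ∀ i ∈ u, ∀ j ∉ u, f (insert j (u.erase i)) = f u)
    {u v : Finset ι} (hu : u.card = k) (hv : v.card = k) : f u = f v := by
  induction hm : (u \ v).card generalizing u with
  | zero =>
    rw [Finset.eq_of_subset_of_card_le
      (Finset.sdiff_eq_empty_iff_subset.1 (Finset.card_eq_zero.1 hm)) (by lia)]
  | succ m ih =>
    obtain ⟨i, hi⟩ : (u \ v).Nonempty := Finset.card_pos.1 (by lia)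
    obtain ⟨j, hj⟩ : (v \ u).Nonempty :=
      Finset.card_pos.1 (by rw [Finset.card_sdiff_comm (hv.trans hu.symm)]; lia)
    rw [Finset.mem_sdiff] at hi hj
    rw [← hf u hu i hi.1 j hj.2]
    refine ih ?_ ?_
    · rw [Finset.card_insert_of_notMem (by simp [hj.2]), Finset.card_erase_add_one hi.1, hu]
    · have : insert j (u.erase i) \ v = (u \ v).erase i := by
        rw [Finset.insert_sdiff_of_mem _ hj.1, Finset.erase_sdiff_comm]
      rw [this, Finset.card_erase_of_mem (Finset.mem_sdiff.2 hi), hm, Nat.add_sub_cancel]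

/-- The relation `(u, v) ↦ v ∪ (u \ {i})` is the one coming from the bracket of `x_i x^v` with
`x^u`. -/
lemma exists_forall_eq_nsmul {ι M : Type*} [DecidableEq ι] [AddCommMonoid M] {f : Finset ι → M}
    (hf₁ : ∀ j, f {j} = 0)
    (hf : ∀ u v, Odd u.card → Odd v.card → ∀ i ∈ u, Disjoint v (u.erase i) →
      f (v ∪ u.erase i) = f v + f u) :
    ∃ c, ∀ k u, u.card = 2 * k + 1 → f u = k • c := by
  have hexch (k : ℕ) (u : Finset ι) (hu : u.card = 2 * k + 1) (i) (hi : i ∈ u) (j) (hj : j ∉ u) :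
      f (insert j (u.erase i)) = f u := by
    have := hf u {j} ⟨k, hu⟩ (by simp) i hi (by simp [hj])
    rwa [hf₁, zero_add] at this
  obtain ⟨c, hc⟩ : ∃ c, ∀ v : Finset ι, v.card = 3 → f v = c := by
    by_cases h : ∃ w : Finset ι, w.card = 3
    · obtain ⟨w, hw⟩ := h
      exact ⟨f w, fun v hv => eq_of_card_eq_of_exchange (hexch 1) hv hw⟩
    · exact ⟨0, fun v hv => (h ⟨v, hv⟩).elim⟩
  refine ⟨c, fun k => ?_⟩
  induction k with
  | zero =>
    intro u hu
    obtain ⟨j, rfl⟩ := Finset.card_eq_one.1 hu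
    rw [hf₁, zero_nsmul]
  | succ k ih =>
    intro u hu
    obtain ⟨v, hvu, hv⟩ := Finset.exists_subset_card_eq (show 3 ≤ u.card by lia)
    obtain ⟨i, hi⟩ : v.Nonempty := Finset.card_pos.1 (by lia)
    have hi' : i ∉ u \ v := by simp [hi]
    have hcard : (insert i (u \ v)).card = 2 * k + 1 := by
      rw [Finset.card_insert_of_notMem hi', Finset.card_sdiff_of_subset hvu]
      lia
    have := hf (insert i (u \ v)) v ⟨k, hcard⟩ ⟨1, hv⟩ i (Finset.mem_insert_self _ _)
      (by rw [Finset.erase_insert hi']; exact Finset.disjoint_sdiff)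
    rwa [Finset.erase_insert hi', Finset.union_sdiff_of_subset hvu, hc v hv, ih _ hcard,
      ← succ_nsmul'] at this

lemma weight_zero_injective : Function.Injective (weight F (0 : Fin n → ℕ)) := fun u w h => by
  ext i
  have := congrFun h i
  by_cases hu : i ∈ u <;> by_cases hw : i ∈ w <;> simp [weight, hu, hw] at this ⊢

lemma TH_mono_add_single_mono_zero {i : Fin n} {u : Finset (Fin n)} (hi : i ∈ u)
    (β : Fin n → ℕ) : TH (mono (β + Pi.single i 1) {i} : O F n) (mono 0 u) = mono β u := by
  rw [TH_mono_singleton, Finset.sum_eq_single i]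
  · rw [mul_mono_del_inr_mono]
    simp [hi, del_inl_mono, binom]
  · intro l _ hl
    have : ¬ Disjoint {i} (u.erase l) := by simp [hi, hl.symm]
    rw [del_inr_mono]
    split_ifs <;> simp only [map_smul, map_zero, mul_mono, if_neg this, smul_zero]
  · simp

lemma sub_choose_two_eq (h2 : (2 : F) ≠ 0) {b : ℕ} (hb : ((b + 2 : ℕ) : F) = 0) :
    ((b + 1 : ℕ) : F) - ((b + 1).choose 2 : F) = -2 := by
  have hchoose := congrArg (Nat.cast (R := F)) (Nat.add_one_mul_choose_eq b 1)
  push_cast [Nat.choose_one_right] at hb hchoose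
  refine mul_right_cancel₀ h2 ?_
  push_cast
  linear_combination hchoose + (3 - (b : F)) * hb

namespace KillsLinear

lemma map_TH {Φ : Module.End F (O F n)} (hΦ : KillsLinear p t Φ) {α : Fin n → ℕ}
    (hα : α ∈ box p t) (j : Fin n) {b : O F n} (hb : b ∈ oddOT F p t) :
    Φ (TH (mono α {j}) b) = TH (mono α {j}) (Φ b) := by
  rw [oddDer.map_TH hΦ.mem_oddDer (mono_singleton_mem_oddOT hα j) hb, hΦ.map_mono_singleton hα,
    map_zero, LinearMap.zero_apply, zero_add]

variable [hp : Fact p.Prime] {Φ : Module.End F (O F n)} (hΦ : KillsLinear p t Φ)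
include hΦ

lemma isReduced (ht : ∀ i, 1 ≤ t i) : IsReduced p t Φ where
  mem_oddDer := hΦ.mem_oddDer
  map_mono_zero := hΦ.map_mono_singleton zero_mem_box
  map_torus i := hΦ.map_mono_singleton (single_one_mem_box ht i) i

lemma map_mono_zero (ht : ∀ i, 1 ≤ t i) {u : Finset (Fin n)} (hu : Odd u.card) :
    Φ (mono 0 u) = Φ (mono 0 u) (0, u) • mono 0 u := by
  ext ⟨γ, w⟩
  rw [Finsupp.smul_apply, mono_apply]
  split_ifs with h
  · rw [← h.1, ← h.2, smul_eq_mul, mul_one]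
  · rw [smul_zero]
    by_contra hne
    obtain ⟨rfl, hw⟩ := (hΦ.isReduced ht).eq_zero_and_weight_eq ht zero_mem_box hu
      (fun i => by simp [del_inl_mono]) hne
    exact h ⟨rfl, (weight_zero_injective hw).symm⟩

lemma map_mono_of_add_one_lt (ht : ∀ i, 1 ≤ t i) {α : Fin n → ℕ} (hα : α ∈ box p t)
    {u : Finset (Fin n)} (hu : Odd u.card) {i : Fin n} (hi : i ∈ u) (hlt : α i + 1 < p ^ t i) :
    Φ (mono α u) = Φ (mono 0 u) (0, u) • mono α u := by
  have hbox : α + Pi.single i 1 ∈ box p t := fun k => by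
    obtain rfl | hk := eq_or_ne k i
    · simpa using hlt
    · simpa [hk] using hα k
  rw [← TH_mono_add_single_mono_zero hi, hΦ.map_TH hbox i (mono_mem_oddOT zero_mem_box hu),
    hΦ.map_mono_zero ht hu, map_smul]
  simp [mono_apply]

lemma map_mono [CharP F p] (h2 : (2 : F) ≠ 0) (ht : ∀ i, 1 ≤ t i) {α : Fin n → ℕ}
    (hα : α ∈ box p t) {u : Finset (Fin n)} (hu : Odd u.card) :
    Φ (mono α u) = Φ (mono 0 u) (0, u) • mono α u := by
  obtain ⟨i, hi⟩ := Finset.card_pos.1 hu.pos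
  obtain hlt | htop := (Nat.succ_le_of_lt (hα i)).lt_or_eq
  · exact hΦ.map_mono_of_add_one_lt ht hα hu hi hlt
  have hp2 : 2 < p := lt_of_le_of_ne hp.out.two_le (by
    rintro rfl
    exact h2 (CharP.cast_eq_zero F 2))
  have htop2 : 2 < p ^ t i := hp2.trans_le (Nat.le_self_pow (Nat.one_le_iff_ne_zero.1 (ht i)) p)
  obtain ⟨β, rfl⟩ := exists_add_single (i := i) (α := α) (by lia)
  have hβi : β i + 2 = p ^ t i := by simpa using htop
  have hβ : β ∈ box p t := mem_box_of_le le_self_add hα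
  have hTH : TH (mono (Pi.single i 2) {i} : O F n) (mono β u) =
      (-2 : F) • mono (β + Pi.single i 1) u := by
    rw [TH_mono_single_mono i 1, if_pos hi, Nat.choose_one_right, add_comm 1, sub_choose_two_eq h2]
    rw [hβi, Nat.cast_pow, CharP.cast_eq_zero, zero_pow (Nat.one_le_iff_ne_zero.1 (ht i))]
  have := hΦ.map_TH (single_mem_box htop2) i (mono_mem_oddOT hβ hu)
  rw [hΦ.map_mono_of_add_one_lt ht hβ hu hi (by lia), map_smul, hTH, map_smul, smul_comm] at this
  exact smul_right_injective _ (neg_ne_zero.2 h2) this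

lemma apply_mono_zero_union [CharP F p] (h2 : (2 : F) ≠ 0) (ht : ∀ i, 1 ≤ t i)
    {u v : Finset (Fin n)} (hu : Odd u.card) (hv : Odd v.card) {i : Fin n} (hi : i ∈ u)
    (huv : Disjoint v (u.erase i)) :
    Φ (mono 0 (v ∪ u.erase i)) (0, v ∪ u.erase i) =
      Φ (mono 0 v) (0, v) + Φ (mono 0 u) (0, u) := by
  have hbox := single_one_mem_box (p := p) ht i
  have := oddDer.map_TH hΦ.mem_oddDer (mono_mem_oddOT hbox hv) (mono_mem_oddOT zero_mem_box hu)
  rw [hΦ.map_mono h2 ht hbox hv, hΦ.map_mono_zero ht hu, map_smul, map_smul, LinearMap.smul_apply,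
    ← add_smul, TH_mono_single_one_mono_zero hi hv huv, map_smul, smul_comm] at this
  have hne := mul_ne_zero (sgn_ne_zero (F := F) {i} u) (sgn_ne_zero (F := F) v (u.erase i))
  have hcoeff := smul_right_injective (O F n) hne this
  simpa [mono_apply] using DFunLike.congr_fun hcoeff (0, v ∪ u.erase i)

lemma exists_eq_smul_Gam_sub_one [CharP F p] (h2 : (2 : F) ≠ 0) (ht : ∀ i, 1 ≤ t i) :
    ∃ c : F, ∀ a ∈ oddOT F p t, Φ a = (c • (Gam F n - 1) : Module.End F (O F n)) a := by
  obtain ⟨c, hc⟩ := exists_forall_eq_nsmul (f := fun u => Φ (mono 0 u) (0, u))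
    (fun j => by simp [hΦ.map_mono_singleton zero_mem_box])
    fun u v hu hv i hi huv => hΦ.apply_mono_zero_union h2 ht hu hv hi huv
  refine ⟨c / 2, eqOn_oddOT (Ψ := (c / 2) • (Gam F n - 1)) fun α hα u hu => ?_⟩
  obtain ⟨k, hk⟩ := hu
  rw [hΦ.map_mono h2 ht hα ⟨k, hk⟩, hc k u hk, LinearMap.smul_apply, LinearMap.sub_apply,
    Module.End.one_apply, Gam_mono, hk]
  match_scalars
  field_simp
  ring

end KillsLinear

lemma TH_add_smul_mem_oddDer [Fact p.Prime] [CharP F p] {z : O F n} (hz : z ∈ oddOT F p t) (c : F) :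
    TH z + c • (Gam F n - 1) ∈ oddDer F p t :=
  add_mem (TH_mem_oddDer hz) (Submodule.smul_mem _ c Gam_sub_one_mem_oddDer)

theorem oddDer.exists_eq [Fact p.Prime] [CharP F p] (h2 : (2 : F) ≠ 0) (ht : ∀ i, 1 ≤ t i)
    {Φ : Module.End F (O F n)} (hΦ : Φ ∈ oddDer F p t) :
    ∃ z ∈ oddOT F p t, ∃ (c : F) (d : Fin n → ℕ → F), ∀ a ∈ oddOT F p t,
      Φ a = (TH z + c • (Gam F n - 1) + delPowers F p t d : Module.End F (O F n)) a := by
  obtain ⟨z, hz, hreduced⟩ := exists_isReduced ht hΦ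
  obtain ⟨d, hkills⟩ := hreduced.exists_killsLinear h2 ht
  obtain ⟨c, hc⟩ := hkills.exists_eq_smul_Gam_sub_one h2 ht
  refine ⟨z, hz, c, d, fun a ha => ?_⟩
  have := hc a ha
  rw [LinearMap.sub_apply, LinearMap.sub_apply, sub_sub, sub_eq_iff_eq_add] at this
  rw [this, LinearMap.add_apply, LinearMap.add_apply]
  abel

lemma delPowers_eq_zero_of_forall_eq [hp : Fact p.Prime] (ht : ∀ i, 1 ≤ t i) {z : O F n}
    (hz : z ∈ oddOT F p t) {c : F} {d : Fin n → ℕ → F}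
    (h : ∀ a ∈ oddOT F p t,
      (TH z + c • (Gam F n - 1) : Module.End F (O F n)) a = delPowers F p t d a) :
    delPowers F p t d = 0 := by
  have hlin (α : Fin n → ℕ) (hα : α ∈ box p t) (j : Fin n) :
      TH z (mono α {j}) = delPowers F p t d (mono α {j}) := by
    simpa [Gam_mono] using h _ (mono_singleton_mem_oddOT hα j)
  have hz0 : z = 0 := by
    refine eq_zero_of_del_of_torus hz.2 (fun i => ?_) fun i => ?_
    · rw [← TH_apply_mono_zero hz.2, hlin 0 zero_mem_box, delPowers_mono_eq_zero d (by simp)]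
    · rw [← neg_eq_zero, ← TH_apply_torus hz.2]
      exact (hlin _ (single_one_mem_box ht i) i).trans (delPowers_torus d i)
  rw [delPowers_eq_sum]
  refine Finset.sum_eq_zero fun i _ => Finset.sum_eq_zero fun k hk => ?_
  have hbox : Pi.single i (p ^ k) ∈ box p t :=
    single_mem_box (Nat.pow_lt_pow_right hp.out.one_lt (Finset.mem_Ico.1 hk).2)
  rw [← delPowers_mono_single (p := p) d hk {i}, ← hlin _ hbox, hz0, map_zero,
    LinearMap.zero_apply, Finsupp.zero_apply, zero_smul]

/-! ### Transport to `𝓗𝓞` -/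

variable [hp : Fact p.Prime]

lemma injOn_TH_oddOT (ht : ∀ i, 1 ≤ t i) : Set.InjOn TH (oddOT F p t : Set (O F n)) := by
  refine fun a ha b hb h => sub_eq_zero.1 ?_
  refine eq_zero_of_forall_TH_eq_zero (p := p) ht (sub_mem ha hb).2 fun c _ => ?_
  rw [map_sub, h, sub_self, LinearMap.zero_apply]

variable [CharP F p]

lemma TH_mem_HOeven {a : O F n} (ha : a ∈ oddOT F p t) : TH a ∈ HOeven F p t :=
  ⟨⟨a, ha.1, rfl⟩, fun j f hf => by
    have := TH_mem_parityPart ha.2 hf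
    rwa [add_right_comm, CharTwo.add_self_eq_zero, zero_add] at this⟩

lemma mem_HOeven_iff {D : Module.End F (O F n)} :
    D ∈ HOeven F p t ↔ ∃ a ∈ oddOT F p t, TH a = D := by
  refine ⟨fun hD => ?_, ?_⟩
  · obtain ⟨a, ha, ha', h⟩ := exists_odd_of_mem hD.1 hD.2
    exact ⟨a, ⟨ha, ha'⟩, h⟩
  · rintro ⟨a, ha, rfl⟩
    exact TH_mem_HOeven ha

/-- `T_H` as an isomorphism from the odd part of `𝒪(n,n;t)` onto `𝓗𝓞`. -/
noncomputable def oddOTEquiv (ht : ∀ i, 1 ≤ t i) : oddOT F p t ≃ₗ[F] HOeven F p t :=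
  LinearEquiv.ofBijective
    (LinearMap.codRestrict (HOeven F p t).toSubmodule (TH.domRestrict (oddOT F p t))
      fun a => TH_mem_HOeven a.2)
    ⟨fun a b h => Subtype.ext (injOn_TH_oddOT ht a.2 b.2 (congrArg Subtype.val h)), fun D => by
      obtain ⟨a, ha, h⟩ := mem_HOeven_iff.1 D.2
      exact ⟨⟨a, ha⟩, Subtype.ext h⟩⟩

/-- The map `T_H(a) ↦ T_H(Φ(a))` on `𝓗𝓞`, for an operator `Φ` on `𝒪(n,n)`. -/
noncomputable def toHO (ht : ∀ i, 1 ≤ t i) :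
    Module.End F (O F n) →ₗ[F] HOeven F p t →ₗ[F] Module.End F (O F n) where
  toFun Φ := TH ∘ₗ Φ ∘ₗ (oddOT F p t).subtype ∘ₗ (oddOTEquiv ht).symm.toLinearMap
  map_add' Φ Ψ := by
    ext1 D
    simp
  map_smul' c Φ := by
    ext1 D
    simp

lemma toHO_apply (ht : ∀ i, 1 ≤ t i) (Φ : Module.End F (O F n)) {a : O F n} (ha : a ∈ oddOT F p t)
    (hD : TH a ∈ HOeven F p t) : toHO ht Φ ⟨TH a, hD⟩ = TH (Φ a) := by
  have : (oddOTEquiv ht).symm ⟨TH a, hD⟩ = ⟨a, ha⟩ := (oddOTEquiv ht).symm_apply_apply ⟨a, ha⟩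
  change TH (Φ ((oddOTEquiv ht).symm ⟨TH a, hD⟩ : O F n)) = TH (Φ a)
  rw [this]

lemma eq_toHO_iff {ht : ∀ i, 1 ≤ t i} {ψ : HOeven F p t →ₗ[F] Module.End F (O F n)}
    {Φ : Module.End F (O F n)} :
    ψ = toHO ht Φ ↔ ∀ a (ha : a ∈ oddOT F p t), ψ ⟨TH a, TH_mem_HOeven ha⟩ = TH (Φ a) := by
  refine ⟨?_, fun h => LinearMap.ext ?_⟩
  · rintro rfl a ha
    exact toHO_apply ht Φ ha _
  · rintro ⟨D, hD⟩
    obtain ⟨a, ha, rfl⟩ := mem_HOeven_iff.1 hD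
    rw [h a ha, toHO_apply ht Φ ha]

lemma toHO_eq_toHO_iff {ht : ∀ i, 1 ≤ t i} {Φ Ψ : Module.End F (O F n)} (hΦ : Φ ∈ oddDer F p t)
    (hΨ : Ψ ∈ oddDer F p t) : toHO ht Φ = toHO ht Ψ ↔ ∀ a ∈ oddOT F p t, Φ a = Ψ a := by
  rw [eq_toHO_iff]
  refine forall₂_congr fun a ha => ?_
  rw [toHO_apply ht Φ ha, (injOn_TH_oddOT ht).eq_iff (hΦ.1 a ha) (hΨ.1 a ha)]

lemma restrictHO_ad_eq_toHO {ht : ∀ i, 1 ≤ t i} {X Φ : Module.End F (O F n)}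
    (h : ∀ a ∈ oddOT F p t, ⁅X, TH a⁆ = TH (Φ a)) :
    restrictHO F p t (LieAlgebra.ad F (Module.End F (O F n)) X) = toHO ht Φ :=
  eq_toHO_iff.2 h

lemma toHO_mem_derHO {ht : ∀ i, 1 ≤ t i} {Φ : Module.End F (O F n)} (hΦ : Φ ∈ oddDer F p t) :
    toHO ht Φ ∈ derHO F p t := by
  have hmem (D : HOeven F p t) : toHO ht Φ D ∈ HOeven F p t :=
    TH_mem_HOeven (hΦ.1 _ ((oddOTEquiv ht).symm D).2)
  refine ⟨⟨LinearMap.codRestrict (HOeven F p t).toSubmodule (toHO ht Φ) hmem, ?_⟩, fun _ => rfl⟩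
  rintro ⟨D, hD⟩ ⟨E, hE⟩
  obtain ⟨a, ha, rfl⟩ := mem_HOeven_iff.1 hD
  obtain ⟨b, hb, rfl⟩ := mem_HOeven_iff.1 hE
  apply Subtype.ext
  change toHO ht Φ ⟨⁅TH a, TH b⁆, _⟩ = ⁅TH a, toHO ht Φ ⟨TH b, hE⟩⁆ - ⁅TH b, toHO ht Φ ⟨TH a, hD⟩⁆
  simp only [TH_bracket ha.2 hb.2]
  rw [toHO_apply ht Φ (TH_mem_oddOT ha hb), toHO_apply ht Φ ha, toHO_apply ht Φ hb,
    oddDer.map_TH hΦ ha hb, TH_bracket ha.2 (hΦ.1 b hb).2, ← lie_skew, sub_neg_eq_add,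
    TH_bracket (hΦ.1 a ha).2 hb.2, map_add, add_comm]

lemma mem_derHO_iff (ht : ∀ i, 1 ≤ t i) {ψ : HOeven F p t →ₗ[F] Module.End F (O F n)} :
    ψ ∈ derHO F p t ↔ ∃ Φ ∈ oddDer F p t, ψ = toHO ht Φ := by
  refine ⟨?_, by rintro ⟨Φ, hΦ, rfl⟩; exact toHO_mem_derHO hΦ⟩
  rintro ⟨φ, hφ⟩
  let e := oddOTEquiv (F := F) (p := p) ht
  obtain ⟨Ψ, hΨ⟩ := LinearMap.exists_extend (V' := oddOT F p t) (p := oddOT F p t)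
    (e.symm.toLinearMap ∘ₗ φ.toLinearMap ∘ₗ e.toLinearMap)
  have hval (a) (ha : a ∈ oddOT F p t) :
      (φ ⟨TH a, TH_mem_HOeven ha⟩ : Module.End F (O F n)) = TH (Ψ a : O F n) := by
    have : Ψ a = e.symm (φ (e ⟨a, ha⟩)) := LinearMap.congr_fun hΨ ⟨a, ha⟩
    rw [this]
    exact congrArg Subtype.val (e.apply_symm_apply _).symm
  refine ⟨(oddOT F p t).subtype ∘ₗ Ψ, ⟨fun a _ => (Ψ a).2, fun a ha b hb => ?_⟩,
    eq_toHO_iff.2 fun a ha => (hφ _).trans (hval a ha)⟩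
  refine injOn_TH_oddOT ht (Ψ _).2
    (add_mem (TH_mem_oddOT (Ψ a).2 hb) (TH_mem_oddOT ha (Ψ b).2)) ?_
  have hlie : (⟨TH (TH a b), TH_mem_HOeven (TH_mem_oddOT ha hb)⟩ : HOeven F p t) =
      ⁅(⟨TH a, TH_mem_HOeven ha⟩ : HOeven F p t), ⟨TH b, TH_mem_HOeven hb⟩⁆ :=
    Subtype.ext (TH_bracket ha.2 hb.2).symm
  calc TH (Ψ (TH a b) : O F n)
      = ⁅TH a, TH (Ψ b : O F n)⁆ + ⁅TH (Ψ a : O F n), TH b⁆ := by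
        rw [← hval _ (TH_mem_oddOT ha hb), hlie, φ.apply_lie_eq_add, ← hval a ha, ← hval b hb]
        rfl
    _ = TH (TH (Ψ a : O F n) b + TH a (Ψ b : O F n)) := by
        rw [TH_bracket ha.2 (Ψ b).2.2, TH_bracket (Ψ a).2.2 hb.2, ← map_add, add_comm]

lemma mem_adHOGam_iff (ht : ∀ i, 1 ≤ t i) {ψ : HOeven F p t →ₗ[F] Module.End F (O F n)} :
    ψ ∈ adHOGam F p t ↔
      ∃ z ∈ oddOT F p t, ∃ c : F, ψ = toHO ht (TH z + c • (Gam F n - 1)) := by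
  have had {z : O F n} (hz : z ∈ oddOT F p t) (c : F) :
      restrictHO F p t (LieAlgebra.ad F (Module.End F (O F n)) (TH z + c • Gam F n)) =
        toHO ht (TH z + c • (Gam F n - 1)) :=
    restrictHO_ad_eq_toHO fun a ha => by
      rw [← LieAlgebra.ad_apply (R := F), map_add, map_smul, LinearMap.add_apply,
        LinearMap.smul_apply, LieAlgebra.ad_apply, LieAlgebra.ad_apply, TH_bracket hz.2 ha.2,
        lie_Gam_TH ha.2, LinearMap.add_apply, LinearMap.smul_apply, map_add, map_smul]
  constructor
  · rintro ⟨X, hX, rfl⟩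
    obtain ⟨D, hD, G, hG, rfl⟩ := Submodule.mem_sup.1 hX
    obtain ⟨z, hz, rfl⟩ := mem_HOeven_iff.1 hD
    obtain ⟨c, rfl⟩ := Submodule.mem_span_singleton.1 hG
    exact ⟨z, hz, c, had hz c⟩
  · rintro ⟨z, hz, c, rfl⟩
    exact ⟨_, Submodule.add_mem_sup (TH_mem_HOeven hz)
      (Submodule.smul_mem _ c (Submodule.mem_span_singleton_self _)), had hz c⟩

lemma mem_adPowers_iff (ht : ∀ i, 1 ≤ t i) {ψ : HOeven F p t →ₗ[F] Module.End F (O F n)} :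
    ψ ∈ adPowers F p t ↔ ∃ d, ψ = toHO ht (delPowers F p t d) := by
  classical
  have had (i : Fin n) (k : ℕ) :
      restrictHO F p t (LieAlgebra.ad F (Module.End F (O F n)) (del (.inl i)) ^ p ^ k) =
        toHO ht (del (.inl i) ^ p ^ k) := by
    rw [ad_pow_char_pow]
    exact restrictHO_ad_eq_toHO fun a ha => lie_del_pow_TH ha.2 i k
  suffices adPowers F p t = LinearMap.range (toHO ht ∘ₗ delPowers F p t) by
    rw [this, LinearMap.mem_range]
    exact exists_congr fun d => eq_comm
  refine le_antisymm (Submodule.span_le.2 ?_) ?_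
  · rintro _ ⟨i, k, hk, hkt, rfl⟩
    refine ⟨Pi.single i (Pi.single k 1), ?_⟩
    rw [had, LinearMap.comp_apply, delPowers_eq_sum,
      Finset.sum_eq_single_of_mem i (Finset.mem_univ i) fun j _ hj => by simp [hj],
      Finset.sum_eq_single_of_mem k (Finset.mem_Ico.2 ⟨hk, hkt⟩) fun l _ hl => by simp [hl]]
    simp
  · rintro _ ⟨d, rfl⟩
    simp only [LinearMap.comp_apply, delPowers_eq_sum, map_sum, map_smul, ← had]
    refine Submodule.sum_mem _ fun i _ => Submodule.sum_mem _ fun k hk => ?_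
    exact Submodule.smul_mem _ _
      (Submodule.subset_span ⟨i, k, (Finset.mem_Ico.1 hk).1, (Finset.mem_Ico.1 hk).2, rfl⟩)

theorem derHO_eq_adHOGam_sup_adPowers (hp2 : p ≠ 2) (ht : ∀ i, 1 ≤ t i) :
    derHO F p t = adHOGam F p t ⊔ adPowers F p t := by
  ext ψ
  simp only [Submodule.mem_sup, mem_derHO_iff ht, mem_adHOGam_iff ht, mem_adPowers_iff ht]
  constructor
  · rintro ⟨Φ, hΦ, rfl⟩
    obtain ⟨z, hz, c, d, h⟩ := oddDer.exists_eq (Ring.two_ne_zero (ringChar.eq F p ▸ hp2)) ht hΦ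
    refine ⟨_, ⟨z, hz, c, rfl⟩, _, ⟨d, rfl⟩, ?_⟩
    rw [← map_add]
    exact ((toHO_eq_toHO_iff hΦ
      (add_mem (TH_add_smul_mem_oddDer hz c) (delPowers_mem_oddDer d))).2 h).symm
  · rintro ⟨_, ⟨z, hz, c, rfl⟩, _, ⟨d, rfl⟩, rfl⟩
    exact ⟨_, add_mem (TH_add_smul_mem_oddDer hz c) (delPowers_mem_oddDer d), (map_add _ _ _).symm⟩

theorem disjoint_adHOGam_adPowers (ht : ∀ i, 1 ≤ t i) :
    Disjoint (adHOGam F p t) (adPowers F p t) := by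
  rw [Submodule.disjoint_def]
  intro ψ hinner hpowers
  obtain ⟨z, hz, c, rfl⟩ := (mem_adHOGam_iff ht).1 hinner
  obtain ⟨d, hd⟩ := (mem_adPowers_iff ht).1 hpowers
  have h := (toHO_eq_toHO_iff (TH_add_smul_mem_oddDer hz c) (delPowers_mem_oddDer d)).1 hd
  rw [hd, delPowers_eq_zero_of_forall_eq ht hz h, map_zero]

end

end OddHamiltonian

theorem mainTheorem1_general (F : Type*) [Field F] (p : ℕ) [Fact p.Prime] [CharP F p] (hp : p ≠ 2)
    (n : ℕ) (t : Fin n → ℕ) (ht : ∀ i, 1 ≤ t i) :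
    OddHamiltonian.derHO F p t = OddHamiltonian.adHOGam F p t ⊔ OddHamiltonian.adPowers F p t ∧
      Disjoint (OddHamiltonian.adHOGam F p t) (OddHamiltonian.adPowers F p t) :=
  ⟨OddHamiltonian.derHO_eq_adHOGam_sup_adPowers hp ht,
    OddHamiltonian.disjoint_adHOGam_adPowers ht⟩

theorem mainTheorem1 (F : Type*) [Field F] (p : ℕ) [Fact p.Prime] [CharP F p] (hp : 3 < p)
    (n : ℕ) (hn : 3 ≤ n) (t : Fin n → ℕ) (ht : ∀ i, 1 ≤ t i) :
    OddHamiltonian.derHO F p t = OddHamiltonian.adHOGam F p t ⊔ OddHamiltonian.adPowers F p t ∧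
      Disjoint (OddHamiltonian.adHOGam F p t) (OddHamiltonian.adPowers F p t) :=
  mainTheorem1_general F p (by lia) n t ht
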